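/- Logarithms are to base 2, $\log 0=-\infty$ and $0\log 0=0$. For a finite-dimensional density matrix $\rho$ let $S(\rho)=-\mathrm{Tr}\,\rho\log\rho$. For a state $\rho^{AB}$ with $\rho^B=\mathrm{Tr}_A\,\rho^{AB}$ let $S(A|B)_\rho=S(\rho^{AB})-S(\rho^B)$. **Gambling.** Suppose the outcome $i$ has probability $p_i$ and payoff $o_i$-for-1. A bet consists of numbers $q_0,q_i\ge 0$ with $q_0+\sum_i q_i=1$; $q_0$ is the retained fraction of the wealth. It multiplies the wealth by $q_0+q_io_i$ when the outcome is $i$, and its doubling rate is $\sum_i p_i\log(q_0+q_io_i)$. It is proportional if $q_0=0$ and $q_i=p_i$. When gambling on a quantum system of dimension $n$ in state $\rho$, Alice also chooses a measurement $\{E_i\}_{i=1}^n$, a complete set of mutually orthogonal projectors of rank one, and $p_i=\mathrm{Tr}\,\rho E_i$. The maximum of the doubling rate over bets is denoted by $W^{*}$, the maximum over bets and measurements by $W^{**}$. **The alternating game.** Let $\rho=\rho^{ABC}$ be a state on $\mathcal H_A\otimes\mathcal H_B\otimes\mathcal H_C$ (finite-dimensional), and let the odds be uniform and fair or super-fair: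 every outcome of $A$, of $B$ and of $C$ pays $o$-for-1, where $o\ge\max(\dim\mathcal H_A,\dim\mathcal H_B,\dim\mathcal H_C)$, and every outcome of $AB$ and of $AC$ pays $o^2$-for-1. There are $K\ge1$ gambles, each on a fresh copy of $\rho$. Bob holds $B$ in $fK$ of them (an integer) and $C$ in the other $(1-f)K$. Alice fixes a measurement of $AB$ and a bet on its outcomes for the former gambles, and a measurement of $AC$ and a bet for the latter. At the end she keeps the fraction $2^{-fKW_B^{**}-(1-f)KW_C^{**}}$ of her wealth, where $W_B^{**}$ and $W_C^{**}$ are the optimum rates for gambling on $B$ alone and on $C$ alone, and Bob gets the rest. The doubling rate of her strategy is $\frac1K$ times the expected logarithm of the factor $S_K$ by which her wealth has changed after Bob has been paid; $W^{**}_{A|BC}$ is its maximum over her strategies. **Theorem.** 1. $W_B^{**}=\log o-S(\rho^B)$ and $W_C^{**}=\log o-S(\rho^C)$, and these maxima are attained. 2. For every $K\ge 1$, every $f$ with $fK$ an integer between $0$ and $K$, and every choice of the $fK$ gambles in which Bob holds $B$, $$W^{**}_{A|BC}=\log(o)-f\,S(A|B)_\rho-(1-f)\,S(A|C)_\rho .$$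 The maximum is attained by every strategy that measures $AB$ and $AC$ in eigenbases of $\rho^{AB}$ and $\rho^{AC}$ and bets proportionally. 3. The doubling rate is the exponent at which the take-home wealth grows. For every strategy of Alice, every $f$ and $w\in\mathbb R$, and all $\varepsilon,\delta>0$ there is $K_0$ such that, for all $K\ge K_0$ with $fK$ an integer and every choice of the $fK$ gambles with $B$, if the strategy has doubling rate $w$ then $\Pr\left[2^{K(w-\varepsilon)}\le S_K\le 2^{K(w+\varepsilon)}\right]>1-\delta$. 4. $S(A|B)_\rho+S(A|C)_\rho\ge 0$. Hence for $f=1/2$ (and $K$ even) no strategy of Alice has a doubling rate above $\log o$. The same bound holds for classical gambling. In the classical version of the game the outcomes are random variables $A,B,C$ (taking $\dim\mathcal H_A$, $\dim\mathcal H_B$, $\dim\mathcal H_C$ values) with a joint distribution, Alice chooses only the bets, and Bob's share is computed with $W_B^{*}$ and $W_C^{*}$. For every $K\ge1$ and every choice of the gambles with $B$, the largest doubling rate over all joint distributions and all bets is exactly $\log o$. -/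

import Mathlib

open scoped Matrix ComplexOrder

noncomputable section

namespace QuantumGambling

/-! ### States, reduced states, entropies -/

section States

variable {m n l : Type*} [Fintype m] [DecidableEq m] [Fintype n] [DecidableEq n]
  [Fintype l] [DecidableEq l]

/-- A density matrix on the Hilbert space with orthonormal basis indexed by `n`. -/
def IsState (ρ : Matrix n n ℂ) : Prop := ρ.PosSemidef ∧ ρ.trace = 1

/-- The partial trace over the first factor of a bipartite system. -/
def traceFst (ρ : Matrix (m × n) (m × n) ℂ) : Matrix n n ℂ :=
  fun j j' => ∑ i, ρ (i, j) (i, j')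

/-- The reduced state of the first and second factors of a tripartite system. -/
def reduceAB (ρ : Matrix (m × n × l) (m × n × l) ℂ) : Matrix (m × n) (m × n) ℂ :=
  fun x y => ∑ k, ρ (x.1, x.2, k) (y.1, y.2, k)

/-- The reduced state of the first and third factors of a tripartite system. -/
def reduceAC (ρ : Matrix (m × n × l) (m × n × l) ℂ) : Matrix (m × l) (m × l) ℂ :=
  fun x y => ∑ j, ρ (x.1, j, x.2) (y.1, j, y.2)

/-- The von Neumann entropy `- Tr ρ log ρ`, in bits. The logarithm is applied by the functional
calculus; the value `Real.logb 2 0 = 0` realises the convention `0 log 0 = 0`. -/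
def entropy (ρ : Matrix n n ℂ) : ℝ :=
  -(ρ * cfc (Real.logb 2) ρ).trace.re

/-- The conditional entropy `S(A|B) = S(A,B) - S(B)` of a state of `AB`. -/
def condEntropy (ρ : Matrix (m × n) (m × n) ℂ) : ℝ :=
  entropy ρ - entropy (traceFst ρ)

end States

/-! ### Betting on a random outcome -/

section Betting

variable {n : Type*} [Fintype n] [DecidableEq n]

/-- A distribution of the wealth: the fraction `stake i` is put on the outcome `i`, and the fraction
`retained` is not gambled with. -/
structure Bet (n : Type*) [Fintype n] where
  retained : ℝ
  stake : n → ℝ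
  retained_nonneg : 0 ≤ retained
  stake_nonneg : ∀ i, 0 ≤ stake i
  sum_eq_one : retained + ∑ i, stake i = 1

/-- The factor by which the wealth changes when the outcome is `i` and the payoffs are
`odds i`-for-1. -/
def Bet.factor (q : Bet n) (odds : n → ℝ) (i : n) : ℝ := q.retained + q.stake i * odds i

/-- Proportional gambling: the bet equals the distribution of the outcome. -/
def Bet.IsProportional (q : Bet n) (p : n → ℝ) : Prop := q.retained = 0 ∧ q.stake = p

/-- The logarithm to base 2 of a nonnegative number, with `log 0 = -∞`. -/
def log2 (x : ℝ) : EReal := if 0 < x then (Real.logb 2 x : EReal) else ⊥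

/-- The doubling rate `∑ i, p i * log (q₀ + q i * o i)`; it is `-∞` for a bet that loses everything
with positive probability (recall `0 * ⊥ = 0` in `EReal`). -/
def doublingRate (p odds : n → ℝ) (q : Bet n) : EReal :=
  ∑ i, (p i : EReal) * log2 (q.factor odds i)

/-- `W*`: the doubling rate optimised over the bets. -/
def optRate (p odds : n → ℝ) : EReal := ⨆ q : Bet n, doublingRate p odds q

/-- The payoffs `(oA i * oB j)`-for-1 for a pair of outcomes. -/
def prodOdds {m n : Type*} (oA : m → ℝ) (oB : n → ℝ) (x : m × n) : ℝ := oA x.1 * oB x.2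

/-- A measurement with as many outcomes as the dimension of the system: a complete set of mutually
orthogonal projectors of rank one. -/
structure Measurement (n : Type*) [Fintype n] [DecidableEq n] where
  proj : n → Matrix n n ℂ
  isHermitian : ∀ i, (proj i).IsHermitian
  mul_eq : ∀ i j, proj i * proj j = if i = j then proj i else 0
  rank_eq_one : ∀ i, (proj i).rank = 1
  sum_eq_one : ∑ i, proj i = 1

/-- The probability `Tr ρ E_i` of the outcome `i`. -/
def Measurement.prob (E : Measurement n) (ρ : Matrix n n ℂ) (i : n) : ℝ :=
  (ρ * E.proj i).trace.re

/-- The measurement is in an eigenbasis of `ρ`. -/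
def Measurement.IsEigenbasis (E : Measurement n) (ρ : Matrix n n ℂ) : Prop :=
  ∃ ev : n → ℝ, ∀ i, ρ * E.proj i = (ev i : ℂ) • E.proj i

/-- `W**`: the doubling rate optimised over both the measurements and the bets. -/
def optQuantumRate (ρ : Matrix n n ℂ) (odds : n → ℝ) : EReal :=
  ⨆ E : Measurement n, optRate (E.prob ρ) odds

end Betting

/-! ### `K` gambles in which the helper holds `B` or `C`

`T` is the set of the gambles in which Bob holds `B`; he holds `C` in all others. In a gamble of `T`
Alice gambles on a device with outcomes in `β` (the composite of her system and `B`), in the others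
on one with outcomes in `γ` (the composite of her system and `C`). -/

section Alternating

variable {β γ : Type*} [Fintype β] [Fintype γ] {K : ℕ}

/-- The outcomes of all `K` gambles. -/
abbrev History (β γ : Type*) (T : Finset (Fin K)) : Type _ :=
  ({k // k ∈ T} → β) × ({k // k ∉ T} → γ)

/-- The outcomes of different gambles are independent; each is distributed as `pB` in the gambles of
`T` and as `pC` in the others. -/
def historyProb (T : Finset (Fin K)) (pB : β → ℝ) (pC : γ → ℝ) (ω : History β γ T) : ℝ :=
  (∏ k, pB (ω.1 k)) * ∏ k, pC (ω.2 k)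

/-- The factor by which Alice's wealth has changed after `K` gambles and after Bob has been paid.
A single gamble multiplies the wealth by `XB` or `XC` of its outcome. Of the result Alice
keeps the fraction `2 ^ (-(#T * WB + (K - #T) * WC))`, and Bob receives the rest. -/
def takeHome (T : Finset (Fin K)) (XB : β → ℝ) (XC : γ → ℝ) (WB WC : ℝ) (ω : History β γ T) : ℝ :=
  (2 : ℝ) ^ (-((T.card : ℝ) * WB + ((K : ℝ) - T.card) * WC)) *
    ((∏ k, XB (ω.1 k)) * ∏ k, XC (ω.2 k))

/-- The doubling rate of the wealth that Alice takes home: the expected logarithm of its growth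
factor, per gamble. -/
def takeHomeRate (T : Finset (Fin K)) (pB : β → ℝ) (pC : γ → ℝ) (XB : β → ℝ) (XC : γ → ℝ)
    (WB WC : ℝ) : EReal :=
  (∑ ω : History β γ T, (historyProb T pB pC ω : EReal) * log2 (takeHome T XB XC WB WC ω)) /
    ((K : ℝ) : EReal)

/-- The probability that the factor `takeHome` lies in the set `I`. -/
def takeHomeProb (T : Finset (Fin K)) (pB : β → ℝ) (pC : γ → ℝ) (XB : β → ℝ) (XC : γ → ℝ)
    (WB WC : ℝ) (I : Set ℝ) : ℝ :=
  ∑ ω : History β γ T, {ω | takeHome T XB XC WB WC ω ∈ I}.indicator (historyProb T pB pC) ω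

end Alternating

section Games

variable {a b c : Type*} [Fintype a] [DecidableEq a] [Fintype b] [DecidableEq b]
  [Fintype c] [DecidableEq c] {K : ℕ}

/-- A strategy of Alice in the quantum game: a measurement of `AB` and a bet on its outcomes for the
gambles in which Bob holds `B`, and the same for `AC` and `C`. -/
structure Strategy (a b c : Type*) [Fintype a] [DecidableEq a] [Fintype b] [DecidableEq b]
    [Fintype c] [DecidableEq c] where
  measAB : Measurement (a × b)
  betAB : Bet (a × b)
  measAC : Measurement (a × c)
  betAC : Bet (a × c)

/-- Measuring `AB` and `AC` in eigenbases of their states and betting proportionally. -/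
def Strategy.IsEigenProportional (σ : Strategy a b c)
    (ρ : Matrix (a × b × c) (a × b × c) ℂ) : Prop :=
  σ.measAB.IsEigenbasis (reduceAB ρ) ∧ σ.betAB.IsProportional (σ.measAB.prob (reduceAB ρ)) ∧
  σ.measAC.IsEigenbasis (reduceAC ρ) ∧ σ.betAC.IsProportional (σ.measAC.prob (reduceAC ρ))

/-- The doubling rate of Alice's take-home wealth in the alternating quantum game, where Bob's share
is computed with the optimum rates `W_B**` and `W_C**` of gambling on `B` and on `C` alone. -/
def Strategy.rate (σ : Strategy a b c) (ρ : Matrix (a × b × c) (a × b × c) ℂ)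
    (oA : a → ℝ) (oB : b → ℝ) (oC : c → ℝ) (T : Finset (Fin K)) : EReal :=
  takeHomeRate T (σ.measAB.prob (reduceAB ρ)) (σ.measAC.prob (reduceAC ρ))
    (σ.betAB.factor (prodOdds oA oB)) (σ.betAC.factor (prodOdds oA oC))
    (optQuantumRate (traceFst (reduceAB ρ)) oB).toReal
    (optQuantumRate (traceFst (reduceAC ρ)) oC).toReal

/-- The probability that, in the alternating quantum game, the factor by which Alice's wealth has
changed when she takes it home lies in `I`. -/
def Strategy.growthProb (σ : Strategy a b c) (ρ : Matrix (a × b × c) (a × b × c) ℂ)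
    (oA : a → ℝ) (oB : b → ℝ) (oC : c → ℝ) (T : Finset (Fin K)) (I : Set ℝ) : ℝ :=
  takeHomeProb T (σ.measAB.prob (reduceAB ρ)) (σ.measAC.prob (reduceAC ρ))
    (σ.betAB.factor (prodOdds oA oB)) (σ.betAC.factor (prodOdds oA oC))
    (optQuantumRate (traceFst (reduceAB ρ)) oB).toReal
    (optQuantumRate (traceFst (reduceAC ρ)) oC).toReal I

/-- The doubling rate of Alice's take-home wealth in the alternating classical game: the outcomes
are those of random variables `A`, `B`, `C` with joint distribution `p`, Alice chooses only
the bets, and Bob's share is computed with the optimum rates `W_B*` and `W_C*`. -/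
def classicalRate (p : a × b × c → ℝ) (qAB : Bet (a × b)) (qAC : Bet (a × c))
    (oA : a → ℝ) (oB : b → ℝ) (oC : c → ℝ) (T : Finset (Fin K)) : EReal :=
  takeHomeRate T (fun x : a × b => ∑ k, p (x.1, x.2, k)) (fun x : a × c => ∑ j, p (x.1, j, x.2))
    (qAB.factor (prodOdds oA oB)) (qAC.factor (prodOdds oA oC))
    (optRate (fun j => ∑ i, ∑ k, p (i, j, k)) oB).toReal
    (optRate (fun k => ∑ i, ∑ j, p (i, j, k)) oC).toReal

end Games

end QuantumGambling

end

open QuantumGambling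

namespace QuantumGambling

set_option linter.unusedSectionVars false

/-! Taking logarithms makes the game additive. The expected logarithm of Alice's final factor is the
sum of the single-gamble rates minus Bob's exponent. With odds at least the number of outcomes,
`q.factor / o` is a subprobability, so Gibbs' inequality bounds a single rate by `log o - H(p)`,
with equality for proportional bets (`sum_mul_logb_factor_le`). Passing from the spectrum of a state
to the outcome distribution of a rank-one measurement is a doubly stochastic map, so `H(p) ≥ S(ρ)`,
with equality in an eigenbasis (`Measurement.sum_prob_mul_logb_le`). Subtracting Bob's rates turns
`S(AB)` and `S(AC)` into conditional entropies. Concentration of the wealth is Chebyshev's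
inequality for a sum of independent terms (`one_sub_le_takeHomeProb`).

The deep ingredient is strong subadditivity, `S(A|B) + S(A|C) ≥ 0`. For a pure state the sum is
zero, because complementary reductions have the same nonzero spectrum. A general state is a sum of
unnormalised pure ones, so superadditivity of `S(A|B)` suffices; since `S(A|B)` is minus the
relative entropy of `P` to `1 ⊗ P_B`, this is subadditivity of relative entropy
(`relativeEntropy_subadditive`).

For the latter, the resolvent sum `R(t) = ∑ |⟨v_j, u_i⟩|² p_i² / (q_j + t p_i)` is a supremum of
functionals jointly linear in `P` and `Q`, hence subadditive. Its primitive `L(t)` tends to `Tr P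
log Q` as `t → 0` and behaves like `Tr P log P + Tr P · log t` as `t → ∞`. Comparing the primitives
at both ends gives the inequality. In the classical game, monotonicity of Shannon entropy, `H(AB) ≥
H(B)`, plays the role of strong subadditivity. -/

/-! ### Diagonalisations -/

/-- `U` is a unitary matrix whose columns are eigenvectors of `ρ`, with eigenvalues `ev`. -/
structure Diagonalizes {n : Type*} [Fintype n] [DecidableEq n] (U : Matrix n n ℂ) (ev : n → ℝ)
    (ρ : Matrix n n ℂ) : Prop where
  star_mul : Uᴴ * U = 1
  eq : ρ = U * Matrix.diagonal (fun i => (ev i : ℂ)) * Uᴴ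

section Diagonalizes

variable {n : Type*} [Fintype n] [DecidableEq n] {U : Matrix n n ℂ} {ev : n → ℝ}
  {ρ : Matrix n n ℂ}

theorem Diagonalizes.mul_star (h : Diagonalizes U ev ρ) : U * Uᴴ = 1 :=
  mul_eq_one_comm.mp h.star_mul

theorem Diagonalizes.star_mul_mul (h : Diagonalizes U ev ρ) :
    Uᴴ * ρ * U = Matrix.diagonal (fun i => (ev i : ℂ)) := by
  rw [h.eq]
  calc Uᴴ * (U * Matrix.diagonal (fun i => (ev i : ℂ)) * Uᴴ) * U
      = (Uᴴ * U) * Matrix.diagonal (fun i => (ev i : ℂ)) * (Uᴴ * U) := by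
        simp only [Matrix.mul_assoc]
    _ = _ := by rw [h.star_mul, Matrix.one_mul, Matrix.mul_one]

theorem Diagonalizes.mul_eq (h : Diagonalizes U ev ρ) :
    ρ * U = U * Matrix.diagonal (fun i => (ev i : ℂ)) := by
  rw [h.eq, Matrix.mul_assoc, h.star_mul, Matrix.mul_one]

theorem diagonalizes_eigenvectorUnitary (hρ : ρ.IsHermitian) :
    Diagonalizes (hρ.eigenvectorUnitary : Matrix n n ℂ) hρ.eigenvalues ρ where
  star_mul := by
    rw [← Matrix.star_eq_conjTranspose]
    exact Unitary.coe_star_mul_self hρ.eigenvectorUnitary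
  eq := by
    conv_lhs => rw [hρ.spectral_theorem, Unitary.conjStarAlgAut_apply]
    rfl

theorem Diagonalizes.isHermitian (h : Diagonalizes U ev ρ) : ρ.IsHermitian := by
  rw [h.eq]
  unfold Matrix.IsHermitian
  rw [Matrix.conjTranspose_mul, Matrix.conjTranspose_mul, Matrix.conjTranspose_conjTranspose,
    Matrix.diagonal_conjTranspose, Matrix.mul_assoc]
  congr 3
  ext i
  simp

theorem Diagonalizes.nonneg (h : Diagonalizes U ev ρ) (hρ : ρ.PosSemidef) (i : n) : 0 ≤ ev i := by
  have h1 := (hρ.conjTranspose_mul_mul_same U).diag_nonneg (i := i)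
  rw [h.star_mul_mul] at h1
  simpa using h1

theorem Diagonalizes.sum_eq_trace (h : Diagonalizes U ev ρ) : ∑ i, ev i = ρ.trace.re := by
  rw [h.eq, Matrix.trace_mul_comm, ← Matrix.mul_assoc, h.star_mul, Matrix.one_mul,
    Matrix.trace_diagonal]
  simp

-- Any diagonalisation determines the same multiset of eigenvalues, so the entropy can be computed
-- in whichever eigenbasis is convenient.
open Polynomial in
theorem Diagonalizes.roots_charpoly (h : Diagonalizes U ev ρ) :
    ρ.charpoly.roots = Multiset.map (fun i => (ev i : ℂ)) Finset.univ.val := by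
  have : ρ.charpoly = ∏ i, (X - C (ev i : ℂ)) := by
    rw [h.eq, Matrix.charpoly_mul_comm, ← Matrix.mul_assoc, h.star_mul, Matrix.one_mul,
      Matrix.charpoly_diagonal]
  rw [this, Polynomial.roots_prod]
  · simp
  · simp [Finset.prod_ne_zero_iff, Polynomial.X_sub_C_ne_zero]

theorem entropy_eq_eigenvalues (hρ : ρ.IsHermitian) :
    entropy ρ = -∑ i, hρ.eigenvalues i * Real.logb 2 (hρ.eigenvalues i) := by
  have h := diagonalizes_eigenvectorUnitary hρ
  have h2 : cfc (Real.logb 2) ρ = (hρ.eigenvectorUnitary : Matrix n n ℂ) *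
      Matrix.diagonal (fun i => (Real.logb 2 (hρ.eigenvalues i) : ℂ)) *
      (hρ.eigenvectorUnitary : Matrix n n ℂ)ᴴ := by
    rw [hρ.cfc_eq, Matrix.IsHermitian.cfc, Unitary.conjStarAlgAut_apply]
    rfl
  unfold entropy
  rw [h2, ← Matrix.mul_assoc, ← Matrix.mul_assoc, h.mul_eq, Matrix.trace_mul_comm,
    Matrix.mul_assoc, ← Matrix.mul_assoc, h.star_mul, Matrix.one_mul, Matrix.diagonal_mul_diagonal,
    Matrix.trace_diagonal]
  simp

/-- The entropy depends only on the characteristic polynomial. -/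
theorem entropy_eq_roots (hρ : ρ.IsHermitian) :
    entropy ρ = -(ρ.charpoly.roots.map (fun z : ℂ => z.re * Real.logb 2 z.re)).sum := by
  rw [entropy_eq_eigenvalues hρ, hρ.roots_charpoly_eq_eigenvalues]
  simp

theorem Diagonalizes.entropy_eq (h : Diagonalizes U ev ρ) :
    entropy ρ = -∑ i, ev i * Real.logb 2 (ev i) := by
  rw [entropy_eq_roots h.isHermitian, h.roots_charpoly]
  simp

end Diagonalizes

/-- `M * Mᴴ` and `(Mᴴ * M)ᵀ` have the same nonzero spectrum. -/
theorem entropy_mul_conjTranspose {m n : Type*} [Fintype m] [DecidableEq m] [Fintype n]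
    [DecidableEq n] (M : Matrix m n ℂ) :
    entropy (M * Mᴴ) = entropy (Mᴴ * M)ᵀ := by
  rw [entropy_eq_roots (Matrix.isHermitian_mul_conjTranspose_self M),
    entropy_eq_roots (Matrix.isHermitian_conjTranspose_mul_self M).transpose,
    Matrix.charpoly_transpose]
  -- The characteristic polynomials agree up to powers of `X`; the extra zero roots contribute
  -- nothing to the entropy sum.
  have h := congrArg Polynomial.roots (Matrix.charpoly_mul_comm' M Mᴴ)
  rw [Polynomial.roots_mul, Polynomial.roots_mul] at h
  · have h3 := congrArg (fun s => (s.map (fun z : ℂ => z.re * Real.logb 2 z.re)).sum) h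
    simpa [Multiset.map_nsmul, Multiset.sum_nsmul] using h3
  · exact mul_ne_zero (pow_ne_zero _ Polynomial.X_ne_zero) (Matrix.charpoly_monic _).ne_zero
  · exact mul_ne_zero (pow_ne_zero _ Polynomial.X_ne_zero) (Matrix.charpoly_monic _).ne_zero

/-! ### Subadditivity of the relative entropy -/

section Relative

variable {n : Type*} [Fintype n]

/-- The overlaps `|⟨v_j, u_i⟩|²` of the columns of `V` and `U`. -/
noncomputable def overlap (V U : Matrix n n ℂ) (j i : n) : ℝ := ‖(Vᴴ * U) j i‖ ^ 2

theorem overlap_nonneg (V U : Matrix n n ℂ) (j i : n) : 0 ≤ overlap V U j i := by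
  unfold overlap; positivity

theorem conjTranspose_mul_mul_diag_eq [DecidableEq n] {U V P : Matrix n n ℂ} {p : n → ℝ}
    (hP : Diagonalizes U p P) (j : n) :
    (Vᴴ * P * V) j j = ((∑ i, overlap V U j i * p i : ℝ) : ℂ) := by
  have : Vᴴ * P * V = (Vᴴ * U) * Matrix.diagonal (fun i => (p i : ℂ)) * (Vᴴ * U)ᴴ := by
    rw [hP.eq, Matrix.conjTranspose_mul, Matrix.conjTranspose_conjTranspose]
    simp only [Matrix.mul_assoc]
  rw [this, Matrix.mul_apply]
  push_cast
  refine Finset.sum_congr rfl fun i _ => ?_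
  rw [Matrix.mul_diagonal, Matrix.conjTranspose_apply, overlap]
  push_cast
  rw [← Complex.mul_conj', Complex.star_def]
  ring

/-- `Vᴴ * U` is unitary, so each of its columns is a unit vector. -/
theorem sum_overlap [DecidableEq n] {U V : Matrix n n ℂ} (hU : Uᴴ * U = 1) (hV : Vᴴ * V = 1) (i : n) :
    ∑ j, overlap V U j i = 1 := by
  have h : (Vᴴ * U)ᴴ * (Vᴴ * U) = 1 := by
    rw [Matrix.conjTranspose_mul, Matrix.conjTranspose_conjTranspose]
    calc Uᴴ * V * (Vᴴ * U) = Uᴴ * (V * Vᴴ) * U := by simp only [Matrix.mul_assoc]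
      _ = 1 := by rw [mul_eq_one_comm.mp hV, Matrix.mul_one, hU]
  have h2 := congrFun (congrFun h i) i
  rw [Matrix.mul_apply, Matrix.one_apply_eq] at h2
  have h3 : ((∑ j, overlap V U j i : ℝ) : ℂ) = 1 := by
    rw [← h2]
    push_cast
    refine Finset.sum_congr rfl fun j _ => ?_
    rw [Matrix.conjTranspose_apply, overlap]
    push_cast
    rw [← Complex.conj_mul', Complex.star_def]
  exact_mod_cast h3

/-- A function that is jointly linear in `P` and `Q`; its supremum over `Z` is
`∑ |⟨v_j, u_i⟩|² p_i² / (q_j + t p_i)`. -/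
noncomputable def variational (t : ℝ) (P Q Z : Matrix n n ℂ) : ℝ :=
  2 * (Zᴴ * P).trace.re - (Zᴴ * (Q * Z)).trace.re - t * (Zᴴ * (Z * P)).trace.re

/-- With `Z` held fixed on both sides, this additivity is the source of every subadditivity below.
-/
theorem variational_add (t : ℝ) (P₁ P₂ Q₁ Q₂ Z : Matrix n n ℂ) :
    variational t (P₁ + P₂) (Q₁ + Q₂) Z = variational t P₁ Q₁ Z + variational t P₂ Q₂ Z := by
  simp only [variational, Matrix.mul_add, Matrix.add_mul, Matrix.trace_add, Complex.add_re]
  ring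

/-- Rotating `Z` into the two eigenbases decouples the quadratic functional into independent scalar
problems, one for each matrix entry. -/
theorem variational_eq [DecidableEq n] {U V P Q : Matrix n n ℂ} {p q : n → ℝ}
    (hP : Diagonalizes U p P) (hQ : Diagonalizes V q Q) (t : ℝ) (z : Matrix n n ℂ) :
    variational t P Q (V * z * Uᴴ) = ∑ i, ∑ j,
      (2 * ((starRingEnd ℂ) (z j i) * (Vᴴ * U) j i).re * p i - ‖z j i‖ ^ 2 * (q j + t * p i)) := by
  have hc : (V * z * Uᴴ)ᴴ = U * (zᴴ * Vᴴ) := by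
    simp [Matrix.conjTranspose_mul]
  have h1 : ((V * z * Uᴴ)ᴴ * P).trace
      = ∑ i, ∑ j, (starRingEnd ℂ) (z j i) * (Vᴴ * U) j i * p i := by
    have : ((V * z * Uᴴ)ᴴ * P).trace
        = (zᴴ * ((Vᴴ * U) * Matrix.diagonal (fun i => (p i : ℂ)))).trace := by
      rw [hc, Matrix.mul_assoc, Matrix.trace_mul_comm, Matrix.mul_assoc, Matrix.mul_assoc,
        hP.mul_eq, Matrix.mul_assoc Vᴴ]
    rw [this]
    simp only [Matrix.trace, Matrix.diag_apply, Matrix.mul_apply (M := zᴴ), Matrix.mul_diagonal,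
      Matrix.conjTranspose_apply, Complex.star_def, mul_assoc (starRingEnd ℂ _)]
  have h2 : ((V * z * Uᴴ)ᴴ * (Q * (V * z * Uᴴ))).trace
      = ∑ i, ∑ j, ((‖z j i‖ ^ 2 * q j : ℝ) : ℂ) := by
    have : ((V * z * Uᴴ)ᴴ * (Q * (V * z * Uᴴ))).trace
        = (zᴴ * (Matrix.diagonal (fun i => (q i : ℂ)) * z)).trace := by
      rw [hc, Matrix.mul_assoc, Matrix.trace_mul_comm]
      calc _ = (zᴴ * (Vᴴ * (Q * V) * z * (Uᴴ * U))).trace := by simp only [Matrix.mul_assoc]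
        _ = _ := by
          rw [hQ.mul_eq, ← Matrix.mul_assoc Vᴴ, hQ.star_mul, hP.star_mul, Matrix.one_mul,
            Matrix.mul_one]
    rw [this]
    simp only [Matrix.trace, Matrix.diag_apply, Matrix.mul_apply (M := zᴴ), Matrix.diagonal_mul,
      Matrix.conjTranspose_apply, Complex.star_def]
    refine Finset.sum_congr rfl fun i _ => Finset.sum_congr rfl fun j _ => ?_
    push_cast
    rw [← Complex.conj_mul']
    ring
  have h3 : ((V * z * Uᴴ)ᴴ * ((V * z * Uᴴ) * P)).trace
      = ∑ i, ∑ j, ((‖z j i‖ ^ 2 * p i : ℝ) : ℂ) := by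
    have : ((V * z * Uᴴ)ᴴ * ((V * z * Uᴴ) * P)).trace
        = (zᴴ * (z * Matrix.diagonal (fun i => (p i : ℂ)))).trace := by
      rw [hc, Matrix.mul_assoc, Matrix.trace_mul_comm]
      calc _ = (zᴴ * ((Vᴴ * V) * z * (Uᴴ * (P * U)))).trace := by simp only [Matrix.mul_assoc]
        _ = _ := by
          rw [hP.mul_eq, ← Matrix.mul_assoc Uᴴ, hQ.star_mul, hP.star_mul, Matrix.one_mul,
            Matrix.one_mul]
    rw [this]
    simp only [Matrix.trace, Matrix.diag_apply, Matrix.mul_apply (M := zᴴ), Matrix.mul_diagonal,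
      Matrix.conjTranspose_apply, Complex.star_def]
    refine Finset.sum_congr rfl fun i _ => Finset.sum_congr rfl fun j _ => ?_
    push_cast
    rw [← Complex.conj_mul']
    ring
  unfold variational
  rw [h1, h2, h3]
  simp only [Complex.re_sum, Complex.ofReal_re, Complex.re_mul_ofReal, Finset.mul_sum,
    ← Finset.sum_sub_distrib]
  refine Finset.sum_congr rfl fun i _ => Finset.sum_congr rfl fun j _ => ?_
  ring

/-- The resolvent sum `∑ |⟨v_j, u_i⟩|² p_i² / (q_j + t p_i)`. -/
noncomputable def resolventSum (w : n → n → ℝ) (p q : n → ℝ) (t : ℝ) : ℝ :=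
  ∑ i, ∑ j, w j i * p i * (p i / (q j + t * p i))

/-- By unitarity every `Z` has the form `V * z * Uᴴ`; the bound is then a completed square in each
entry. -/
theorem variational_le [DecidableEq n] {U V P Q : Matrix n n ℂ} {p q : n → ℝ}
    (hP : Diagonalizes U p P) (hQ : Diagonalizes V q Q) (hp : ∀ i, 0 ≤ p i) (hq : ∀ i, 0 ≤ q i)
    {t : ℝ} (ht : 0 < t) (Z : Matrix n n ℂ) :
    variational t P Q Z ≤ resolventSum (overlap V U) p q t := by
  have hZ : Z = V * (Vᴴ * Z * U) * Uᴴ := by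
    calc Z = (V * Vᴴ) * Z * (U * Uᴴ) := by
          rw [hP.mul_star, hQ.mul_star, Matrix.one_mul, Matrix.mul_one]
      _ = _ := by simp only [Matrix.mul_assoc]
  rw [hZ, variational_eq hP hQ]
  refine Finset.sum_le_sum fun i _ => Finset.sum_le_sum fun j _ => ?_
  generalize (Vᴴ * Z * U) j i = z
  unfold overlap
  generalize (Vᴴ * U) j i = w
  have h1 : ((starRingEnd ℂ) z * w).re ≤ ‖z‖ * ‖w‖ := by
    refine (Complex.re_le_norm _).trans ?_
    simp
  rcases (hp i).eq_or_lt with h0 | h0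
  · rw [← h0]
    have := mul_nonneg (sq_nonneg ‖z‖) (hq j)
    simp only [mul_zero, add_zero, zero_mul, zero_sub]
    linarith
  · have hd : 0 < q j + t * p i := add_pos_of_nonneg_of_pos (hq j) (mul_pos ht h0)
    -- The completed square: its expansion is exactly the gap once the real part is replaced by `‖z‖
    -- * ‖w‖`.
    have h2 : 0 ≤ (‖z‖ * (q j + t * p i) - ‖w‖ * p i) ^ 2 / (q j + t * p i) := by positivity
    have h3 : (‖z‖ * (q j + t * p i) - ‖w‖ * p i) ^ 2 / (q j + t * p i)
        = ‖z‖ ^ 2 * (q j + t * p i) - 2 * (‖z‖ * ‖w‖) * p i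
          + ‖w‖ ^ 2 * p i * (p i / (q j + t * p i)) := by
      field_simp
      ring
    nlinarith [mul_le_mul_of_nonneg_right h1 h0.le]

theorem exists_variational_eq [DecidableEq n] {U V P Q : Matrix n n ℂ} {p q : n → ℝ}
    (hP : Diagonalizes U p P) (hQ : Diagonalizes V q Q) (hp : ∀ i, 0 ≤ p i) (hq : ∀ i, 0 ≤ q i)
    {t : ℝ} (ht : 0 < t) :
    ∃ Z, variational t P Q Z = resolventSum (overlap V U) p q t := by
  -- The entrywise maximiser, at which the completed square vanishes.
  refine ⟨V * (Matrix.of fun j i => (Vᴴ * U) j i * ((p i / (q j + t * p i) : ℝ) : ℂ)) * Uᴴ, ?_⟩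
  rw [variational_eq hP hQ]
  refine Finset.sum_congr rfl fun i _ => Finset.sum_congr rfl fun j _ => ?_
  rw [Matrix.of_apply]
  unfold overlap
  generalize (Vᴴ * U) j i = w
  rcases (hp i).eq_or_lt with h0 | h0
  · simp [← h0]
  · have hd : 0 < q j + t * p i := add_pos_of_nonneg_of_pos (hq j) (mul_pos ht h0)
    have h1 : ((starRingEnd ℂ) (w * ((p i / (q j + t * p i) : ℝ) : ℂ)) * w)
        = ((‖w‖ ^ 2 * (p i / (q j + t * p i)) : ℝ) : ℂ) := by
      rw [map_mul, Complex.conj_ofReal]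
      push_cast
      rw [← Complex.conj_mul']
      ring
    rw [h1, Complex.ofReal_re, norm_mul, Complex.norm_real, mul_pow, Real.norm_eq_abs, sq_abs]
    field_simp
    ring

/-- The optimal `Z` for the sum is merely admissible for the two summands. -/
theorem resolventSum_le_add [DecidableEq n] {U₁ V₁ P₁ Q₁ U₂ V₂ P₂ Q₂ U V P Q : Matrix n n ℂ}
    {p₁ q₁ p₂ q₂ p q : n → ℝ}
    (hP₁ : Diagonalizes U₁ p₁ P₁) (hQ₁ : Diagonalizes V₁ q₁ Q₁)
    (hP₂ : Diagonalizes U₂ p₂ P₂) (hQ₂ : Diagonalizes V₂ q₂ Q₂)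
    (hP : Diagonalizes U p P) (hQ : Diagonalizes V q Q) (hPs : P = P₁ + P₂) (hQs : Q = Q₁ + Q₂)
    (hp₁ : ∀ i, 0 ≤ p₁ i) (hq₁ : ∀ i, 0 ≤ q₁ i) (hp₂ : ∀ i, 0 ≤ p₂ i) (hq₂ : ∀ i, 0 ≤ q₂ i)
    (hp : ∀ i, 0 ≤ p i) (hq : ∀ i, 0 ≤ q i) {t : ℝ} (ht : 0 < t) :
    resolventSum (overlap V U) p q t ≤
      resolventSum (overlap V₁ U₁) p₁ q₁ t + resolventSum (overlap V₂ U₂) p₂ q₂ t := by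
  obtain ⟨Z, hZ⟩ := exists_variational_eq hP hQ hp hq ht
  rw [← hZ, hPs, hQs, variational_add]
  exact add_le_add (variational_le hP₁ hQ₁ hp₁ hq₁ ht Z) (variational_le hP₂ hQ₂ hp₂ hq₂ ht Z)

/-- A primitive of `resolventSum`. -/
noncomputable def logSum (w : n → n → ℝ) (p q : n → ℝ) (t : ℝ) : ℝ :=
  ∑ i, ∑ j, w j i * p i * Real.log (q j + t * p i)

theorem hasDerivAt_logSum {w : n → n → ℝ} {p q : n → ℝ} (hp : ∀ i, 0 ≤ p i)
    (hq : ∀ i, 0 ≤ q i) {t : ℝ} (ht : 0 < t) :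
    HasDerivAt (logSum w p q) (resolventSum w p q t) t := by
  unfold logSum resolventSum
  refine HasDerivAt.fun_sum fun i _ => HasDerivAt.fun_sum fun j _ => ?_
  rcases (hp i).eq_or_lt with h0 | h0
  · simpa [← h0] using hasDerivAt_const t (0 : ℝ)
  · have hd : 0 < q j + t * p i := add_pos_of_nonneg_of_pos (hq j) (mul_pos ht h0)
    have h1 : HasDerivAt (fun t : ℝ => q j + t * p i) (p i) t := by
      simpa using ((hasDerivAt_id t).mul_const (p i)).const_add (q j)
    exact (h1.log hd.ne').const_mul _

/-! ### Boundary behaviour of the primitive, and relative entropy -/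

open Filter Topology

/-- The hypothesis says that the support of `P` lies in that of `Q`; it removes the terms whose
logarithm would diverge. -/
theorem tendsto_logSum_zero {w : n → n → ℝ} {p q : n → ℝ}
    (hs : ∀ i j, q j = 0 → w j i * p i = 0) :
    Tendsto (logSum w p q) (𝓝[>] 0) (𝓝 (∑ i, ∑ j, w j i * p i * Real.log (q j))) := by
  unfold logSum
  refine tendsto_finsetSum _ fun i _ => tendsto_finsetSum _ fun j _ => ?_
  by_cases h : q j = 0
  · simp [hs i j h]
  · refine Tendsto.const_mul _ (Tendsto.log ?_ h)
    refine Tendsto.mono_left ?_ nhdsWithin_le_nhds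
    have : Continuous fun t : ℝ => q j + t * p i := by fun_prop
    simpa using this.tendsto 0

/-- Here `log (q + t p) - log t = log (q / t + p)` tends to `log p` when `p > 0`. The unit sums of
`w` make the total coefficient of `log t` equal to `∑ i, p i`. -/
theorem tendsto_logSum_atTop {w : n → n → ℝ} {p q : n → ℝ} (hp : ∀ i, 0 ≤ p i)
    (hq : ∀ i, 0 ≤ q i) (hw : ∀ i, ∑ j, w j i = 1) :
    Tendsto (fun t => logSum w p q t - (∑ i, p i) * Real.log t) atTop
      (𝓝 (∑ i, p i * Real.log (p i))) := by
  have h1 : ∑ i, p i * Real.log (p i) = ∑ i, ∑ j, w j i * p i * Real.log (p i) := by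
    refine Finset.sum_congr rfl fun i _ => ?_
    rw [← Finset.sum_mul, ← Finset.sum_mul, hw, one_mul]
  have h2 : (fun t => logSum w p q t - (∑ i, p i) * Real.log t) =
      fun t => ∑ i, ∑ j, w j i * p i * (Real.log (q j + t * p i) - Real.log t) := by
    funext t
    have : ∑ i, p i = ∑ i, ∑ j, w j i * p i := by
      refine Finset.sum_congr rfl fun i _ => ?_
      rw [← Finset.sum_mul, hw, one_mul]
    rw [this, logSum]
    simp only [Finset.sum_mul, ← Finset.sum_sub_distrib, mul_sub]
  rw [h1, h2]
  refine tendsto_finsetSum _ fun i _ => tendsto_finsetSum _ fun j _ => ?_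
  rcases (hp i).eq_or_lt with h0 | h0
  · simp [← h0]
  · refine Tendsto.const_mul _ ?_
    have h3 : Tendsto (fun t : ℝ => Real.log (q j / t + p i)) atTop (𝓝 (Real.log (p i))) := by
      refine Tendsto.log ?_ h0.ne'
      simpa using (tendsto_id.const_div_atTop (q j)).add_const (p i)
    refine h3.congr' ?_
    filter_upwards [eventually_gt_atTop 0] with t ht
    have hd : 0 < q j + t * p i := add_pos_of_nonneg_of_pos (hq j) (mul_pos ht h0)
    rw [← Real.log_div hd.ne' ht.ne', add_div, mul_div_cancel_left₀ _ ht.ne']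

/-- Subadditivity of the quantum relative entropy `Tr P (log P - log Q)`, written in eigenbases. -/
theorem relativeEntropy_subadditive [DecidableEq n] {U₁ V₁ P₁ Q₁ U₂ V₂ P₂ Q₂ U V P Q : Matrix n n ℂ}
    {p₁ q₁ p₂ q₂ p q : n → ℝ}
    (hP₁ : Diagonalizes U₁ p₁ P₁) (hQ₁ : Diagonalizes V₁ q₁ Q₁)
    (hP₂ : Diagonalizes U₂ p₂ P₂) (hQ₂ : Diagonalizes V₂ q₂ Q₂)
    (hP : Diagonalizes U p P) (hQ : Diagonalizes V q Q) (hPs : P = P₁ + P₂) (hQs : Q = Q₁ + Q₂)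
    (hp₁ : ∀ i, 0 ≤ p₁ i) (hq₁ : ∀ i, 0 ≤ q₁ i) (hp₂ : ∀ i, 0 ≤ p₂ i) (hq₂ : ∀ i, 0 ≤ q₂ i)
    (hp : ∀ i, 0 ≤ p i) (hq : ∀ i, 0 ≤ q i)
    (hs₁ : ∀ i j, q₁ j = 0 → overlap V₁ U₁ j i * p₁ i = 0)
    (hs₂ : ∀ i j, q₂ j = 0 → overlap V₂ U₂ j i * p₂ i = 0)
    (hs : ∀ i j, q j = 0 → overlap V U j i * p i = 0) :
    (∑ i, p i * Real.log (p i)) - ∑ i, ∑ j, overlap V U j i * p i * Real.log (q j) ≤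
      ((∑ i, p₁ i * Real.log (p₁ i)) - ∑ i, ∑ j, overlap V₁ U₁ j i * p₁ i * Real.log (q₁ j)) +
      ((∑ i, p₂ i * Real.log (p₂ i)) - ∑ i, ∑ j, overlap V₂ U₂ j i * p₂ i * Real.log (q₂ j)) := by
  -- The defect of subadditivity of the primitives. It is monotone because its derivative is the
  -- nonnegative defect of the resolvent sums.
  set F : ℝ → ℝ := fun t => logSum (overlap V₁ U₁) p₁ q₁ t + logSum (overlap V₂ U₂) p₂ q₂ t
    - logSum (overlap V U) p q t with hF
  have hder : ∀ t : ℝ, 0 < t → HasDerivAt F (resolventSum (overlap V₁ U₁) p₁ q₁ t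
      + resolventSum (overlap V₂ U₂) p₂ q₂ t - resolventSum (overlap V U) p q t) t := fun t ht =>
    ((hasDerivAt_logSum hp₁ hq₁ ht).add (hasDerivAt_logSum hp₂ hq₂ ht)).sub
      (hasDerivAt_logSum hp hq ht)
  have hmono : MonotoneOn F (Set.Ioi 0) := by
    refine monotoneOn_of_deriv_nonneg (convex_Ioi 0)
      (fun t ht => (hder t ht).continuousAt.continuousWithinAt) ?_ ?_
    · rw [interior_Ioi]
      exact fun t ht => (hder t ht).differentiableAt.differentiableWithinAt
    · rw [interior_Ioi]
      intro t ht
      rw [(hder t ht).deriv]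
      linarith [resolventSum_le_add hP₁ hQ₁ hP₂ hQ₂ hP hQ hPs hQs hp₁ hq₁ hp₂ hq₂ hp hq ht]
  have h0 : Tendsto F (𝓝[>] 0) (𝓝 _) :=
    ((tendsto_logSum_zero hs₁).add (tendsto_logSum_zero hs₂)).sub (tendsto_logSum_zero hs)
  -- Additivity of the trace cancels the divergent `log t` terms in `F` at infinity.
  have htr : ∑ i, p i = ∑ i, p₁ i + ∑ i, p₂ i := by
    rw [hP.sum_eq_trace, hP₁.sum_eq_trace, hP₂.sum_eq_trace, hPs, Matrix.trace_add, Complex.add_re]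
  have h1 : Tendsto F atTop (𝓝 ((∑ i, p₁ i * Real.log (p₁ i)) + (∑ i, p₂ i * Real.log (p₂ i))
      - ∑ i, p i * Real.log (p i))) := by
    refine (((tendsto_logSum_atTop hp₁ hq₁ (sum_overlap hP₁.star_mul hQ₁.star_mul)).add
      (tendsto_logSum_atTop hp₂ hq₂ (sum_overlap hP₂.star_mul hQ₂.star_mul))).sub
      (tendsto_logSum_atTop hp hq (sum_overlap hP.star_mul hQ.star_mul))).congr fun t => ?_
    rw [hF, htr]
    ring
  have h2 : ∀ t : ℝ, 0 < t → F t ≤ (∑ i, p₁ i * Real.log (p₁ i))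
      + (∑ i, p₂ i * Real.log (p₂ i)) - ∑ i, p i * Real.log (p i) := fun t ht =>
    ge_of_tendsto h1 ((eventually_ge_atTop t).mono fun s hs =>
      hmono ht (lt_of_lt_of_le ht hs) hs)
  have h3 := le_of_tendsto h0 (eventually_mem_nhdsWithin.mono fun t ht => h2 t ht)
  linarith

end Relative

/-! ### Reduced states -/

section Reduced

variable {a b c : Type*} [Fintype a] [Fintype b] [Fintype c]

theorem traceFst_eq_sum (P : Matrix (a × b) (a × b) ℂ) :
    traceFst P = ∑ i, P.submatrix (fun j => (i, j)) (fun j => (i, j)) := by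
  ext j j'
  simp [traceFst, Matrix.sum_apply]

theorem reduceAB_eq_sum (ρ : Matrix (a × b × c) (a × b × c) ℂ) :
    reduceAB ρ = ∑ k, ρ.submatrix (fun x => (x.1, x.2, k)) (fun x => (x.1, x.2, k)) := by
  ext x y
  simp [reduceAB, Matrix.sum_apply]

theorem reduceAC_eq_sum (ρ : Matrix (a × b × c) (a × b × c) ℂ) :
    reduceAC ρ = ∑ j, ρ.submatrix (fun x => (x.1, j, x.2)) (fun x => (x.1, j, x.2)) := by
  ext x y
  simp [reduceAC, Matrix.sum_apply]

theorem posSemidef_traceFst {P : Matrix (a × b) (a × b) ℂ} (hP : P.PosSemidef) :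
    (traceFst P).PosSemidef := by
  rw [traceFst_eq_sum]
  exact Matrix.posSemidef_sum _ fun i _ => hP.submatrix _

theorem posSemidef_reduceAB {ρ : Matrix (a × b × c) (a × b × c) ℂ} (hρ : ρ.PosSemidef) :
    (reduceAB ρ).PosSemidef := by
  rw [reduceAB_eq_sum]
  exact Matrix.posSemidef_sum _ fun i _ => hρ.submatrix _

theorem posSemidef_reduceAC {ρ : Matrix (a × b × c) (a × b × c) ℂ} (hρ : ρ.PosSemidef) :
    (reduceAC ρ).PosSemidef := by
  rw [reduceAC_eq_sum]
  exact Matrix.posSemidef_sum _ fun i _ => hρ.submatrix _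

theorem traceFst_zero : traceFst (0 : Matrix (a × b) (a × b) ℂ) = 0 := by
  ext
  simp [traceFst]

theorem trace_traceFst (P : Matrix (a × b) (a × b) ℂ) : (traceFst P).trace = P.trace := by
  simp only [Matrix.trace, Matrix.diag_apply, traceFst, Fintype.sum_prod_type]
  exact Finset.sum_comm

theorem trace_reduceAB (ρ : Matrix (a × b × c) (a × b × c) ℂ) :
    (reduceAB ρ).trace = ρ.trace := by
  simp only [Matrix.trace, Matrix.diag_apply, reduceAB, Fintype.sum_prod_type]

theorem trace_reduceAC (ρ : Matrix (a × b × c) (a × b × c) ℂ) :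
    (reduceAC ρ).trace = ρ.trace := by
  simp only [Matrix.trace, Matrix.diag_apply, reduceAC, Fintype.sum_prod_type]
  exact Finset.sum_congr rfl fun i _ => Finset.sum_comm

theorem IsState.traceFst {P : Matrix (a × b) (a × b) ℂ} (hP : IsState P) :
    IsState (traceFst P) :=
  ⟨posSemidef_traceFst hP.1, by rw [trace_traceFst, hP.2]⟩

theorem IsState.reduceAB {ρ : Matrix (a × b × c) (a × b × c) ℂ} (hρ : IsState ρ) :
    IsState (reduceAB ρ) :=
  ⟨posSemidef_reduceAB hρ.1, by rw [trace_reduceAB, hρ.2]⟩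

theorem IsState.reduceAC {ρ : Matrix (a × b × c) (a × b × c) ℂ} (hρ : IsState ρ) :
    IsState (reduceAC ρ) :=
  ⟨posSemidef_reduceAC hρ.1, by rw [trace_reduceAC, hρ.2]⟩

end Reduced

/-! ### Superadditivity of the conditional entropy -/

section Conditional

variable {a b : Type*} [Fintype a] [DecidableEq a] [Fintype b] [DecidableEq b]

open scoped Kronecker

theorem Diagonalizes.one_kronecker {U σ : Matrix b b ℂ} {s : b → ℝ} (h : Diagonalizes U s σ) :
    Diagonalizes ((1 : Matrix a a ℂ) ⊗ₖ U) (fun x => s x.2) ((1 : Matrix a a ℂ) ⊗ₖ σ) where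
  star_mul := by
    rw [Matrix.conjTranspose_kronecker, ← Matrix.mul_kronecker_mul, h.star_mul,
      Matrix.conjTranspose_one, Matrix.one_mul, Matrix.one_kronecker_one]
  eq := by
    have : Matrix.diagonal (fun x : a × b => (s x.2 : ℂ))
        = (1 : Matrix a a ℂ) ⊗ₖ Matrix.diagonal (fun j => (s j : ℂ)) := by
      rw [← Matrix.diagonal_one, Matrix.diagonal_kronecker_diagonal]
      simp
    rw [this, Matrix.conjTranspose_kronecker, ← Matrix.mul_kronecker_mul,
      ← Matrix.mul_kronecker_mul, ← h.eq, Matrix.conjTranspose_one, Matrix.one_mul, Matrix.one_mul]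

/-- An operator acting on the second factor alone passes through the partial trace over the first.
-/
theorem traceFst_kronecker_conj (P : Matrix (a × b) (a × b) ℂ) (U : Matrix b b ℂ) :
    traceFst (((1 : Matrix a a ℂ) ⊗ₖ U)ᴴ * P * ((1 : Matrix a a ℂ) ⊗ₖ U))
      = Uᴴ * traceFst P * U := by
  ext j j'
  simp only [traceFst, Matrix.mul_apply, Matrix.conjTranspose_apply, Matrix.kronecker_apply,
    Fintype.sum_prod_type, Matrix.one_apply, Finset.sum_mul, Finset.mul_sum]
  simp only [ite_mul, one_mul, zero_mul, apply_ite star, star_zero, mul_ite, mul_zero,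
    Finset.sum_ite_irrel, Finset.sum_const_zero, Finset.sum_ite_eq', Finset.mem_univ, if_true]
  rw [Finset.sum_comm]
  refine Finset.sum_congr rfl fun k _ => ?_
  rw [Finset.sum_comm]

variable {P : Matrix (a × b) (a × b) ℂ} {U : Matrix (a × b) (a × b) ℂ} {p : a × b → ℝ}
  {V : Matrix b b ℂ} {s : b → ℝ}

/-- Both sides are the `j`-th diagonal entry of the reduced matrix in its eigenbasis `V`. -/
theorem sum_overlap_kronecker (hP : Diagonalizes U p P) (hV : Diagonalizes V s (traceFst P))
    (j : b) :
    ∑ i : a, ∑ x, overlap ((1 : Matrix a a ℂ) ⊗ₖ V) U (i, j) x * p x = s j := by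
  have h := congrFun (congrFun (traceFst_kronecker_conj P V) j) j
  rw [hV.star_mul_mul, Matrix.diagonal_apply_eq] at h
  unfold traceFst at h
  simp only [conjTranspose_mul_mul_diag_eq hP] at h
  exact_mod_cast h

/-- The support of `P` lies in that of `1 ⊗ P_B`: a vanishing eigenvalue of `P_B` is a sum of
nonnegative terms of this kind. -/
theorem overlap_kronecker_mul_eq_zero (hP : Diagonalizes U p P) (hp : ∀ x, 0 ≤ p x)
    (hV : Diagonalizes V s (traceFst P)) (x y : a × b) (h : s y.2 = 0) :
    overlap ((1 : Matrix a a ℂ) ⊗ₖ V) U y x * p x = 0 := by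
  have hnn : ∀ y x, 0 ≤ overlap ((1 : Matrix a a ℂ) ⊗ₖ V) U y x * p x := fun y x =>
    mul_nonneg (overlap_nonneg _ _ _ _) (hp x)
  have h1 := sum_overlap_kronecker hP hV y.2
  rw [h, Finset.sum_eq_zero_iff_of_nonneg fun i _ => Finset.sum_nonneg fun x _ => hnn _ _] at h1
  have h2 := h1 y.1 (Finset.mem_univ _)
  rw [Finset.sum_eq_zero_iff_of_nonneg fun x _ => hnn _ _] at h2
  exact h2 x (Finset.mem_univ _)

/-- This is the identity `Tr P log (1 ⊗ P_B) = Tr P_B log P_B` in eigenbases. -/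
theorem sum_overlap_kronecker_mul_log (hP : Diagonalizes U p P)
    (hV : Diagonalizes V s (traceFst P)) :
    ∑ x, ∑ y : a × b, overlap ((1 : Matrix a a ℂ) ⊗ₖ V) U y x * p x * Real.log (s y.2)
      = ∑ j, s j * Real.log (s j) := by
  rw [Finset.sum_comm, Fintype.sum_prod_type, Finset.sum_comm]
  refine Finset.sum_congr rfl fun j _ => ?_
  simp only [← Finset.sum_mul]
  rw [sum_overlap_kronecker hP hV]

theorem Diagonalizes.condEntropy_eq (hP : Diagonalizes U p P)
    (hV : Diagonalizes V s (traceFst P)) :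
    condEntropy P = -((∑ x, p x * Real.log (p x)) - ∑ j, s j * Real.log (s j)) / Real.log 2 := by
  unfold condEntropy
  rw [hP.entropy_eq, hV.entropy_eq]
  simp only [Real.logb, mul_div_assoc', ← Finset.sum_div]
  ring

/-- Up to the unit of the logarithm, `S(A|B)` is minus the relative entropy of `P` to `1 ⊗ P_B`, and
both arguments are additive in `P`. No normalisation is needed, so the statement applies to
unnormalised pieces of a state. -/
theorem condEntropy_superadditive {P₁ P₂ : Matrix (a × b) (a × b) ℂ} (h₁ : P₁.PosSemidef)
    (h₂ : P₂.PosSemidef) : condEntropy P₁ + condEntropy P₂ ≤ condEntropy (P₁ + P₂) := by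
  have h := h₁.add h₂
  have ht₁ := posSemidef_traceFst h₁
  have ht₂ := posSemidef_traceFst h₂
  have ht := posSemidef_traceFst h
  have d₁ := diagonalizes_eigenvectorUnitary h₁.1
  have d₂ := diagonalizes_eigenvectorUnitary h₂.1
  have d := diagonalizes_eigenvectorUnitary h.1
  have e₁ := diagonalizes_eigenvectorUnitary ht₁.1
  have e₂ := diagonalizes_eigenvectorUnitary ht₂.1
  have e := diagonalizes_eigenvectorUnitary ht.1
  have hadd : (1 : Matrix a a ℂ) ⊗ₖ traceFst (P₁ + P₂)
      = (1 : Matrix a a ℂ) ⊗ₖ traceFst P₁ + (1 : Matrix a a ℂ) ⊗ₖ traceFst P₂ := by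
    rw [← Matrix.kronecker_add]
    congr 1
    ext j j'
    simp [traceFst, Finset.sum_add_distrib]
  have key := relativeEntropy_subadditive d₁ e₁.one_kronecker d₂ e₂.one_kronecker d
    e.one_kronecker rfl hadd (d₁.nonneg h₁) (fun x => e₁.nonneg ht₁ x.2) (d₂.nonneg h₂)
    (fun x => e₂.nonneg ht₂ x.2) (d.nonneg h) (fun x => e.nonneg ht x.2)
    (fun x y => overlap_kronecker_mul_eq_zero d₁ (d₁.nonneg h₁) e₁ x y)
    (fun x y => overlap_kronecker_mul_eq_zero d₂ (d₂.nonneg h₂) e₂ x y)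
    (fun x y => overlap_kronecker_mul_eq_zero d (d.nonneg h) e x y)
  rw [sum_overlap_kronecker_mul_log d e, sum_overlap_kronecker_mul_log d₁ e₁,
    sum_overlap_kronecker_mul_log d₂ e₂] at key
  rw [d.condEntropy_eq e, d₁.condEntropy_eq e₁, d₂.condEntropy_eq e₂, ← add_div]
  exact div_le_div_of_nonneg_right (by linarith) (Real.log_nonneg one_le_two)

end Conditional

/-! ### Strong subadditivity -/

section StrongSubadditivity

variable {a b c : Type*} [Fintype a] [DecidableEq a] [Fintype b] [DecidableEq b]
  [Fintype c] [DecidableEq c]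

/-- Reshape `ψ` into a matrix `M` from `C` to `AB`: the two reductions are `M * Mᴴ` and `(Mᴴ * M)ᵀ`.
-/
theorem entropy_reduceAB_pure (ψ : a × b × c → ℂ) :
    entropy (reduceAB (Matrix.vecMulVec ψ (star ψ)))
      = entropy (traceFst (reduceAC (Matrix.vecMulVec ψ (star ψ)))) := by
  let M : Matrix (a × b) c ℂ := Matrix.of fun x k => ψ (x.1, x.2, k)
  have h1 : reduceAB (Matrix.vecMulVec ψ (star ψ)) = M * Mᴴ := by
    ext x y
    simp [reduceAB, Matrix.vecMulVec_apply, Matrix.mul_apply, M]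
  have h2 : traceFst (reduceAC (Matrix.vecMulVec ψ (star ψ))) = (Mᴴ * M)ᵀ := by
    ext k k'
    simp [traceFst, reduceAC, Matrix.vecMulVec_apply, Matrix.mul_apply, M,
      Fintype.sum_prod_type, mul_comm]
  rw [h1, h2, entropy_mul_conjTranspose]

theorem entropy_reduceAC_pure (ψ : a × b × c → ℂ) :
    entropy (reduceAC (Matrix.vecMulVec ψ (star ψ)))
      = entropy (traceFst (reduceAB (Matrix.vecMulVec ψ (star ψ)))) := by
  let M : Matrix (a × c) b ℂ := Matrix.of fun x j => ψ (x.1, j, x.2)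
  have h1 : reduceAC (Matrix.vecMulVec ψ (star ψ)) = M * Mᴴ := by
    ext x y
    simp [reduceAC, Matrix.vecMulVec_apply, Matrix.mul_apply, M]
  have h2 : traceFst (reduceAB (Matrix.vecMulVec ψ (star ψ))) = (Mᴴ * M)ᵀ := by
    ext k k'
    simp [traceFst, reduceAB, Matrix.vecMulVec_apply, Matrix.mul_apply, M,
      Fintype.sum_prod_type, mul_comm]
  rw [h1, h2, entropy_mul_conjTranspose]

theorem condEntropy_add_condEntropy_sum_pure {ι : Type*} (s : Finset ι) (ψ : ι → a × b × c → ℂ) :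
    0 ≤ condEntropy (reduceAB (∑ i ∈ s, Matrix.vecMulVec (ψ i) (star (ψ i))))
      + condEntropy (reduceAC (∑ i ∈ s, Matrix.vecMulVec (ψ i) (star (ψ i)))) := by
  classical
  induction s using Finset.induction_on with
  | empty =>
    have h1 : reduceAB (0 : Matrix (a × b × c) (a × b × c) ℂ) = 0 := by
      ext; simp [reduceAB]
    have h2 : reduceAC (0 : Matrix (a × b × c) (a × b × c) ℂ) = 0 := by
      ext; simp [reduceAC]
    simp [h1, h2, condEntropy, entropy, traceFst_zero]
  | insert i s hi ih =>
    rw [Finset.sum_insert hi]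
    have hp := Matrix.posSemidef_vecMulVec_self_star (ψ i)
    have hs : (∑ i ∈ s, Matrix.vecMulVec (ψ i) (star (ψ i))).PosSemidef :=
      Matrix.posSemidef_sum _ fun i _ => Matrix.posSemidef_vecMulVec_self_star (ψ i)
    generalize ∑ i ∈ s, Matrix.vecMulVec (ψ i) (star (ψ i)) = σ at *
    -- For a pure vector `S(AB) = S(C)` and `S(AC) = S(B)`, so the two conditional entropies cancel.
    have h0 : condEntropy (reduceAB (Matrix.vecMulVec (ψ i) (star (ψ i))))
        + condEntropy (reduceAC (Matrix.vecMulVec (ψ i) (star (ψ i)))) = 0 := by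
      unfold condEntropy
      rw [entropy_reduceAB_pure, entropy_reduceAC_pure]
      ring
    have h1 := condEntropy_superadditive (posSemidef_reduceAB hp) (posSemidef_reduceAB hs)
    have h2 := condEntropy_superadditive (posSemidef_reduceAC hp) (posSemidef_reduceAC hs)
    have h3 : ∀ τ : Matrix (a × b × c) (a × b × c) ℂ,
        reduceAB (τ + σ) = reduceAB τ + reduceAB σ := fun τ => by
      ext; simp [reduceAB, Finset.sum_add_distrib]
    have h4 : ∀ τ : Matrix (a × b × c) (a × b × c) ℂ,
        reduceAC (τ + σ) = reduceAC τ + reduceAC σ := fun τ => by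
      ext; simp [reduceAC, Finset.sum_add_distrib]
    rw [h3, h4]
    linarith

/-- Strong subadditivity of the von Neumann entropy. -/
theorem condEntropy_add_condEntropy_nonneg {ρ : Matrix (a × b × c) (a × b × c) ℂ}
    (hρ : ρ.PosSemidef) : 0 ≤ condEntropy (reduceAB ρ) + condEntropy (reduceAC ρ) := by
  have d := diagonalizes_eigenvectorUnitary hρ.1
  -- Spectral decomposition, with the square root of each eigenvalue absorbed into its eigenvector.
  have h : ρ = ∑ i, Matrix.vecMulVec
      (fun x => (√(hρ.1.eigenvalues i) : ℂ) * (hρ.1.eigenvectorUnitary : Matrix _ _ ℂ) x i)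
      (star fun x =>
        (√(hρ.1.eigenvalues i) : ℂ) * (hρ.1.eigenvectorUnitary : Matrix _ _ ℂ) x i) := by
    ext x y
    conv_lhs => rw [d.eq]
    rw [Matrix.mul_apply, Matrix.sum_apply]
    refine Finset.sum_congr rfl fun i _ => ?_
    rw [Matrix.mul_diagonal, Matrix.vecMulVec_apply, Matrix.conjTranspose_apply]
    simp only [Pi.star_apply, star_mul', Complex.star_def, Complex.conj_ofReal]
    have : (hρ.1.eigenvalues i : ℂ)
        = (√(hρ.1.eigenvalues i) : ℂ) * (√(hρ.1.eigenvalues i) : ℂ) := by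
      rw [← Complex.ofReal_mul, Real.mul_self_sqrt (d.nonneg hρ i)]
    rw [this]
    ring
  rw [h]
  exact condEntropy_add_condEntropy_sum_pure _ _

end StrongSubadditivity

/-! ### Expected logarithms -/

section ExpectedLog

variable {Ω : Type*} [Fintype Ω] {P X : Ω → ℝ}

theorem coe_sum_ereal {ι : Type*} (s : Finset ι) (f : ι → ℝ) :
    ((∑ i ∈ s, f i : ℝ) : EReal) = ∑ i ∈ s, (f i : EReal) := by
  classical
  induction s using Finset.induction_on with
  | empty => simp
  | insert i s hi ih => rw [Finset.sum_insert hi, Finset.sum_insert hi, EReal.coe_add, ih]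

theorem sum_mul_log2_of_pos (hP : ∀ ω, 0 ≤ P ω) (h : ∀ ω, 0 < P ω → 0 < X ω) :
    ∑ ω, (P ω : EReal) * log2 (X ω) = ((∑ ω, P ω * Real.logb 2 (X ω) : ℝ) : EReal) := by
  rw [coe_sum_ereal]
  refine Finset.sum_congr rfl fun ω _ => ?_
  rcases (hP ω).eq_or_lt with h0 | h0
  · simp [← h0]
  · rw [log2, if_pos (h ω h0), EReal.coe_mul]

/-- In `EReal`, `⊥` absorbs every summand, so one ruinous outcome of positive probability decides
the whole sum. -/
theorem sum_mul_log2_eq_bot {ω : Ω} (hP : 0 < P ω) (hX : ¬ 0 < X ω) :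
    ∑ ω, (P ω : EReal) * log2 (X ω) = ⊥ := by
  classical
  rw [← Finset.add_sum_erase _ _ (Finset.mem_univ ω), log2, if_neg hX, EReal.coe_mul_bot_of_pos hP,
    EReal.bot_add]

end ExpectedLog

/-! ### Optimal bets -/

section Bets

variable {n : Type*} [Fintype n] {p : n → ℝ} {o : ℝ}

theorem Bet.factor_nonneg (q : Bet n) {odds : n → ℝ} (ho : ∀ i, 0 ≤ odds i) (i : n) :
    0 ≤ q.factor odds i :=
  add_nonneg q.retained_nonneg (mul_nonneg (q.stake_nonneg i) (ho i))

theorem pos_of_card_le (hp1 : ∑ i, p i = 1) (ho : (Fintype.card n : ℝ) ≤ o) : 0 < o := by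
  have : Nonempty n := by
    by_contra h
    rw [not_nonempty_iff] at h
    simp at hp1
  exact lt_of_lt_of_le (by exact_mod_cast Fintype.card_pos) ho

/-- Fairness or super-fairness enters here: the retained fraction is counted with weight `card n / o
≤ 1`, so retaining wealth never beats betting. -/
theorem Bet.sum_factor_div_le (q : Bet n) (ho0 : 0 < o) (ho : (Fintype.card n : ℝ) ≤ o) :
    ∑ i, q.factor (fun _ => o) i / o ≤ 1 := by
  have h1 : ∑ i, q.factor (fun _ => o) i / o
      = q.retained * (Fintype.card n / o) + ∑ i, q.stake i := by
    simp only [Bet.factor, add_div, mul_div_assoc, div_self ho0.ne', mul_one,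
      Finset.sum_add_distrib, Finset.sum_const, Finset.card_univ, nsmul_eq_mul]
    ring
  have h2 : (Fintype.card n : ℝ) / o ≤ 1 := (div_le_one ho0).2 ho
  have h3 := mul_le_mul_of_nonneg_left h2 q.retained_nonneg
  linarith [q.sum_eq_one]

/-- Pointwise Gibbs' inequality, from `log u ≤ u - 1` at `u = y / x`. The linear error cancels or
has a good sign after summation. -/
theorem mul_logb_le {x y : ℝ} (hx : 0 ≤ x) (hy : 0 ≤ y) (h : 0 < x → 0 < y) :
    x * Real.logb 2 y ≤ x * Real.logb 2 x + (y - x) / Real.log 2 := by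
  have hl : 0 < Real.log 2 := Real.log_pos one_lt_two
  rcases hx.eq_or_lt with h0 | h0
  · rw [← h0]
    simp only [zero_mul, sub_zero, zero_add]
    positivity
  · have h1 := Real.log_le_sub_one_of_pos (div_pos (h h0) h0)
    rw [Real.log_div (h h0).ne' h0.ne'] at h1
    have h2 := mul_le_mul_of_nonneg_left h1 h0.le
    have h3 : x * (y / x - 1) = y - x := by field_simp
    rw [h3] at h2
    simp only [Real.logb]
    rw [← mul_div_assoc, ← mul_div_assoc, ← add_div]
    exact div_le_div_of_nonneg_right (by linarith) hl.le

/-- The doubling rate is at most `log o - H(p)` for fair and super-fair odds. -/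
theorem sum_mul_logb_factor_le (hp : ∀ i, 0 ≤ p i) (hp1 : ∑ i, p i = 1)
    (ho : (Fintype.card n : ℝ) ≤ o) (q : Bet n)
    (h : ∀ i, 0 < p i → 0 < q.factor (fun _ => o) i) :
    ∑ i, p i * Real.logb 2 (q.factor (fun _ => o) i)
      ≤ Real.logb 2 o + ∑ i, p i * Real.logb 2 (p i) := by
  have ho0 := pos_of_card_le hp1 ho
  have hterm : ∀ i, p i * Real.logb 2 (q.factor (fun _ => o) i) ≤
      p i * Real.logb 2 o + p i * Real.logb 2 (p i)
        + (q.factor (fun _ => o) i / o - p i) / Real.log 2 := by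
    intro i
    have h1 := mul_logb_le (hp i) (div_nonneg (q.factor_nonneg (fun _ => ho0.le) i) ho0.le)
      fun hi => div_pos (h i hi) ho0
    rcases (hp i).eq_or_lt with h0 | h0
    · rw [← h0] at h1 ⊢
      simpa using h1
    · rw [Real.logb_div (h i h0).ne' ho0.ne'] at h1
      linarith
  refine (Finset.sum_le_sum fun i _ => hterm i).trans ?_
  rw [Finset.sum_add_distrib, Finset.sum_add_distrib, ← Finset.sum_mul, hp1, one_mul,
    ← Finset.sum_div, Finset.sum_sub_distrib, hp1]
  have := div_nonpos_of_nonpos_of_nonneg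
    (sub_nonpos.2 (q.sum_factor_div_le ho0 ho)) (Real.log_nonneg one_le_two)
  linarith

theorem doublingRate_le (hp : ∀ i, 0 ≤ p i) (hp1 : ∑ i, p i = 1)
    (ho : (Fintype.card n : ℝ) ≤ o) (q : Bet n) :
    doublingRate p (fun _ => o) q ≤
      ((Real.logb 2 o + ∑ i, p i * Real.logb 2 (p i) : ℝ) : EReal) := by
  unfold doublingRate
  by_cases h : ∀ i, 0 < p i → 0 < q.factor (fun _ => o) i
  · rw [sum_mul_log2_of_pos hp h]
    exact_mod_cast sum_mul_logb_factor_le hp hp1 ho q h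
  · push Not at h
    obtain ⟨i, hi, hi'⟩ := h
    rw [sum_mul_log2_eq_bot hi (not_lt.2 hi')]
    exact bot_le

theorem Bet.IsProportional.factor_eq {q : Bet n} (hq : q.IsProportional p) (odds : n → ℝ) (i : n) :
    q.factor odds i = p i * odds i := by
  rw [Bet.factor, hq.1, hq.2, zero_add]

theorem Bet.IsProportional.sum_mul_logb {q : Bet n} (hq : q.IsProportional p)
    (hp1 : ∑ i, p i = 1) (ho : 0 < o) :
    ∑ i, p i * Real.logb 2 (q.factor (fun _ => o) i)
      = Real.logb 2 o + ∑ i, p i * Real.logb 2 (p i) := by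
  have : Real.logb 2 o = ∑ i, p i * Real.logb 2 o := by rw [← Finset.sum_mul, hp1, one_mul]
  rw [this, ← Finset.sum_add_distrib]
  refine Finset.sum_congr rfl fun i _ => ?_
  rw [hq.factor_eq]
  by_cases h0 : p i = 0
  · simp [h0]
  · rw [Real.logb_mul h0 ho.ne']
    ring

theorem Bet.IsProportional.factor_pos {q : Bet n} (hq : q.IsProportional p) (ho : 0 < o) (i : n)
    (hi : 0 < p i) : 0 < q.factor (fun _ => o) i := by
  rw [hq.factor_eq]
  exact mul_pos hi ho

theorem Bet.IsProportional.doublingRate_eq {q : Bet n} (hq : q.IsProportional p)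
    (hp : ∀ i, 0 ≤ p i) (hp1 : ∑ i, p i = 1) (ho : 0 < o) :
    doublingRate p (fun _ => o) q =
      ((Real.logb 2 o + ∑ i, p i * Real.logb 2 (p i) : ℝ) : EReal) := by
  unfold doublingRate
  rw [sum_mul_log2_of_pos hp (hq.factor_pos ho), hq.sum_mul_logb hp1 ho]

theorem exists_isProportional (hp : ∀ i, 0 ≤ p i) (hp1 : ∑ i, p i = 1) :
    ∃ q : Bet n, q.IsProportional p :=
  ⟨⟨0, p, le_rfl, hp, by rw [hp1, zero_add]⟩, rfl, rfl⟩

theorem optRate_eq (hp : ∀ i, 0 ≤ p i) (hp1 : ∑ i, p i = 1) (ho : (Fintype.card n : ℝ) ≤ o) :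
    optRate p (fun _ => o) = ((Real.logb 2 o + ∑ i, p i * Real.logb 2 (p i) : ℝ) : EReal) := by
  obtain ⟨q, hq⟩ := exists_isProportional hp hp1
  refine le_antisymm (iSup_le fun q => doublingRate_le hp hp1 ho q) ?_
  rw [← hq.doublingRate_eq hp hp1 (pos_of_card_le hp1 ho)]
  exact le_iSup (fun q => doublingRate p (fun _ => o) q) q

end Bets

/-! ### Optimal measurements -/

section Measurements

variable {n : Type*} [Fintype n] [DecidableEq n] (E : Measurement n) {ρ U : Matrix n n ℂ}
  {ev : n → ℝ} {o : ℝ}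

theorem Measurement.posSemidef (i : n) : (E.proj i).PosSemidef := by
  have h := Matrix.posSemidef_conjTranspose_mul_self (E.proj i)
  rwa [(E.isHermitian i).eq, E.mul_eq, if_pos rfl] at h

/-- An idempotent Hermitian matrix has eigenvalues 0 and 1 only, so its trace counts the nonzero
ones, which is the rank. -/
theorem Measurement.trace_eq_one (i : n) : (E.proj i).trace = 1 := by
  have h := E.isHermitian i
  have d := diagonalizes_eigenvectorUnitary h
  have h01 : ∀ j, h.eigenvalues j ≠ 0 → h.eigenvalues j = 1 := by
    intro j hj
    have h1 : Matrix.diagonal (fun i => (h.eigenvalues i : ℂ)) *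
        Matrix.diagonal (fun i => (h.eigenvalues i : ℂ))
        = Matrix.diagonal (fun i => (h.eigenvalues i : ℂ)) := by
      have h2 := E.mul_eq i i
      rw [if_pos rfl] at h2
      rw [← d.star_mul_mul]
      calc _ = (h.eigenvectorUnitary : Matrix n n ℂ)ᴴ * E.proj i *
            (h.eigenvectorUnitary * (h.eigenvectorUnitary : Matrix n n ℂ)ᴴ) * E.proj i *
            h.eigenvectorUnitary := by
            simp only [Matrix.mul_assoc]
        _ = _ := by rw [d.mul_star, Matrix.mul_one, Matrix.mul_assoc _ (E.proj i) (E.proj i), h2]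
    rw [Matrix.diagonal_mul_diagonal] at h1
    have h2 := congrFun (congrFun h1 j) j
    rw [Matrix.diagonal_apply_eq, Matrix.diagonal_apply_eq] at h2
    have h3 : h.eigenvalues j * h.eigenvalues j = h.eigenvalues j := by exact_mod_cast h2
    exact mul_right_cancel₀ hj (by rw [h3, one_mul])
  have hr := E.rank_eq_one i
  rw [h.rank_eq_card_non_zero_eigs, Fintype.card_subtype] at hr
  rw [h.trace_eq_sum_eigenvalues,
    ← Finset.sum_filter_of_ne (p := fun j => h.eigenvalues j ≠ 0) (by intro j _ hj; simpa using hj),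
    Finset.sum_congr rfl (g := fun _ => (1 : ℂ)) (by
      intro j hj
      rw [h01 j (Finset.mem_filter.1 hj).2]
      simp),
    Finset.sum_const, hr, one_smul]

/-- The overlaps `⟨u_k, E_i u_k⟩`. -/
noncomputable def Measurement.weight (U : Matrix n n ℂ) (i k : n) : ℝ := ((Uᴴ * E.proj i * U) k k).re

theorem Measurement.weight_nonneg (U : Matrix n n ℂ) (i k : n) : 0 ≤ E.weight U i k := by
  have h := ((E.posSemidef i).conjTranspose_mul_mul_same U).diag_nonneg (i := k)
  exact (Complex.nonneg_iff.1 h).1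

/-- Together with `sum_weight_snd` this makes the weights doubly stochastic: completeness gives one
kind of sum, unit trace of the projectors the other. -/
theorem Measurement.sum_weight_fst (hU : Uᴴ * U = 1) (k : n) : ∑ i, E.weight U i k = 1 := by
  have h : Uᴴ * (∑ i, E.proj i) * U = 1 := by rw [E.sum_eq_one, Matrix.mul_one, hU]
  have h2 := congrArg Complex.re (congrFun (congrFun h k) k)
  rw [Matrix.mul_sum, Matrix.sum_mul, Matrix.sum_apply, Complex.re_sum] at h2
  simpa [Measurement.weight] using h2

theorem Measurement.sum_weight_snd (hU : U * Uᴴ = 1) (i : n) : ∑ k, E.weight U i k = 1 := by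
  have h : (Uᴴ * E.proj i * U).trace = 1 := by
    rw [Matrix.trace_mul_comm, ← Matrix.mul_assoc, hU, Matrix.one_mul, E.trace_eq_one]
  have h2 := congrArg Complex.re h
  rw [Matrix.trace, Complex.re_sum] at h2
  simpa [Measurement.weight] using h2

theorem Measurement.prob_eq (d : Diagonalizes U ev ρ) (i : n) :
    E.prob ρ i = ∑ k, ev k * E.weight U i k := by
  have h : (ρ * E.proj i).trace
      = (Matrix.diagonal (fun i => (ev i : ℂ)) * (Uᴴ * E.proj i * U)).trace := by
    conv_lhs => rw [d.eq]
    rw [Matrix.mul_assoc, Matrix.mul_assoc, Matrix.trace_mul_comm]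
    simp only [Matrix.mul_assoc]
  rw [Measurement.prob, h, Matrix.trace, Complex.re_sum]
  refine Finset.sum_congr rfl fun k _ => ?_
  rw [Matrix.diag_apply, Matrix.diagonal_mul, Complex.re_ofReal_mul, Measurement.weight]

theorem Measurement.prob_nonneg (hρ : IsState ρ) (i : n) : 0 ≤ E.prob ρ i := by
  have d := diagonalizes_eigenvectorUnitary hρ.1.1
  rw [E.prob_eq d]
  exact Finset.sum_nonneg fun k _ => mul_nonneg (d.nonneg hρ.1 k) (E.weight_nonneg _ _ _)

theorem Measurement.sum_prob (hρ : IsState ρ) : ∑ i, E.prob ρ i = 1 := by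
  simp only [Measurement.prob, ← Complex.re_sum]
  rw [← Matrix.trace_sum, ← Matrix.mul_sum, E.sum_eq_one, Matrix.mul_one, hρ.2, Complex.one_re]

/-- The outcomes of a measurement have at least the entropy of the state. -/
theorem Measurement.sum_prob_mul_logb_le (hρ : IsState ρ) :
    ∑ i, E.prob ρ i * Real.logb 2 (E.prob ρ i) ≤ -entropy ρ := by
  have d := diagonalizes_eigenvectorUnitary hρ.1.1
  rw [d.entropy_eq, neg_neg]
  have hev := d.nonneg hρ.1
  have hs1 := d.sum_eq_trace
  replace hs1 := hs1.trans ((congrArg Complex.re hρ.2).trans Complex.one_re)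
  generalize hρ.1.1.eigenvalues = ev at *
  generalize (hρ.1.1.eigenvectorUnitary : Matrix n n ℂ) = U at *
  have hw := E.weight_nonneg U
  have hw1 := E.sum_weight_fst d.star_mul
  have hw2 := E.sum_weight_snd d.mul_star
  have hl : 0 < Real.log 2 := Real.log_pos one_lt_two
  calc ∑ i, E.prob ρ i * Real.logb 2 (E.prob ρ i)
      = ∑ i, ∑ k, E.weight U i k * (ev k * Real.logb 2 (E.prob ρ i)) := by
        refine Finset.sum_congr rfl fun i _ => ?_
        conv_lhs => rw [E.prob_eq d, Finset.sum_mul]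
        refine Finset.sum_congr rfl fun k _ => ?_
        rw [← E.prob_eq d]
        ring
    -- Gibbs' inequality for every pair of an outcome and an eigenvalue; double stochasticity then
    -- cancels the linear errors.
    _ ≤ ∑ i, ∑ k, E.weight U i k *
          (ev k * Real.logb 2 (ev k) + (E.prob ρ i - ev k) / Real.log 2) := by
        refine Finset.sum_le_sum fun i _ => Finset.sum_le_sum fun k _ => ?_
        rcases (hw i k).eq_or_lt with h0 | h0
        · rw [← h0, zero_mul, zero_mul]
        · refine mul_le_mul_of_nonneg_left (mul_logb_le (hev k) (E.prob_nonneg hρ i) fun hk => ?_)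
            h0.le
          rw [E.prob_eq d]
          exact Finset.sum_pos' (fun k _ => mul_nonneg (hev k) (hw i k))
            ⟨k, Finset.mem_univ _, mul_pos hk h0⟩
    _ = ∑ k, (∑ i, E.weight U i k) * (ev k * Real.logb 2 (ev k))
          + (∑ i, (∑ k, E.weight U i k) * E.prob ρ i - ∑ k, (∑ i, E.weight U i k) * ev k)
            / Real.log 2 := by
        simp only [mul_add, Finset.sum_add_distrib, Finset.sum_mul, mul_div_assoc', mul_sub,
          ← Finset.sum_div, Finset.sum_sub_distrib]
        rw [Finset.sum_comm (f := fun i k => E.weight U i k * (ev k * Real.logb 2 (ev k))),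
          Finset.sum_comm (f := fun i k => E.weight U i k * ev k)]
    _ = ∑ k, ev k * Real.logb 2 (ev k) := by
        simp only [hw1, hw2, one_mul, hs1, E.sum_prob hρ, sub_self, zero_div, add_zero]

theorem Measurement.IsEigenbasis.sum_prob_mul_logb {E : Measurement n} (hE : E.IsEigenbasis ρ)
    (hρ : IsState ρ) : ∑ i, E.prob ρ i * Real.logb 2 (E.prob ρ i) = -entropy ρ := by
  have d := diagonalizes_eigenvectorUnitary hρ.1.1
  rw [d.entropy_eq, neg_neg]
  generalize hρ.1.1.eigenvalues = lam at *
  generalize (hρ.1.1.eigenvectorUnitary : Matrix n n ℂ) = U at *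
  obtain ⟨ev, hev⟩ := hE
  have hprob : ∀ i, E.prob ρ i = ev i := by
    intro i
    rw [Measurement.prob, hev, Matrix.trace_smul, E.trace_eq_one]
    simp
  -- Eigenspaces may be degenerate, so `E` need not match the chosen eigenvectors. Positive weight
  -- still forces equal eigenvalues, which is all that the entropy sees.
  have hkey : ∀ i k, E.weight U i k = 0 ∨ lam k = ev i := by
    intro i k
    have h1 : Uᴴ * ρ = Matrix.diagonal (fun i => (lam i : ℂ)) * Uᴴ := by
      rw [← d.star_mul_mul, Matrix.mul_assoc _ U, d.mul_star, Matrix.mul_one]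
    have h2 : (ev i : ℂ) • (Uᴴ * E.proj i * U)
        = Matrix.diagonal (fun i => (lam i : ℂ)) * (Uᴴ * E.proj i * U) := by
      calc (ev i : ℂ) • (Uᴴ * E.proj i * U) = Uᴴ * ((ev i : ℂ) • E.proj i) * U := by
            rw [Matrix.mul_smul, Matrix.smul_mul]
        _ = (Uᴴ * ρ) * E.proj i * U := by rw [← hev]; simp only [Matrix.mul_assoc]
        _ = _ := by rw [h1]; simp only [Matrix.mul_assoc]
    have h3 := congrArg Complex.re (congrFun (congrFun h2 k) k)
    rw [Matrix.diagonal_mul, Matrix.smul_apply, smul_eq_mul, Complex.re_ofReal_mul,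
      Complex.re_ofReal_mul] at h3
    by_cases h0 : E.weight U i k = 0
    · exact Or.inl h0
    · exact Or.inr (mul_right_cancel₀ h0 h3.symm)
  calc ∑ i, E.prob ρ i * Real.logb 2 (E.prob ρ i)
      = ∑ i, ∑ k, E.weight U i k * (ev i * Real.logb 2 (ev i)) := by
        refine Finset.sum_congr rfl fun i _ => ?_
        rw [← Finset.sum_mul, E.sum_weight_snd d.mul_star, one_mul, hprob]
    _ = ∑ i, ∑ k, E.weight U i k * (lam k * Real.logb 2 (lam k)) := by
        refine Finset.sum_congr rfl fun i _ => Finset.sum_congr rfl fun k _ => ?_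
        rcases hkey i k with h | h
        · rw [h, zero_mul, zero_mul]
        · rw [h]
    _ = ∑ k, lam k * Real.logb 2 (lam k) := by
        rw [Finset.sum_comm]
        refine Finset.sum_congr rfl fun k _ => ?_
        rw [← Finset.sum_mul, E.sum_weight_fst d.star_mul, one_mul]

theorem Diagonalizes.exists_measurement (d : Diagonalizes U ev ρ) :
    ∃ E : Measurement n, E.IsEigenbasis ρ := by
  have hdiag : ∀ i, Matrix.diagonal (fun i => (ev i : ℂ)) * Matrix.diagonal (Pi.single i 1)
      = (ev i : ℂ) • Matrix.diagonal (Pi.single i 1) := by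
    intro i
    rw [Matrix.diagonal_mul_diagonal, ← Matrix.diagonal_smul]
    congr 1
    ext j
    by_cases h : j = i
    · subst h; simp
    · simp [h]
  have hmul : ∀ A B : Matrix n n ℂ, (U * A * Uᴴ) * (U * B * Uᴴ) = U * (A * B) * Uᴴ := by
    intro A B
    calc (U * A * Uᴴ) * (U * B * Uᴴ) = U * A * (Uᴴ * U) * (B * Uᴴ) := by
          simp only [Matrix.mul_assoc]
      _ = _ := by rw [d.star_mul, Matrix.mul_one]; simp only [Matrix.mul_assoc]
  refine ⟨⟨fun i => U * Matrix.diagonal (Pi.single i 1) * Uᴴ, fun i => ?_, fun i j => ?_,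
    fun i => ?_, ?_⟩, ev, fun i => ?_⟩
  · refine Matrix.isHermitian_mul_mul_conjTranspose U (Matrix.isHermitian_diagonal_iff.2 fun j => ?_)
    by_cases h : j = i
    · subst h; simp
    · simp [h]
  · rw [hmul, Matrix.diagonal_mul_diagonal]
    split_ifs with h
    · subst h
      congr 3
      ext k
      by_cases h : k = i
      · subst h; simp
      · simp [h]
    · have : (fun k => (Pi.single i 1 : n → ℂ) k * (Pi.single j 1 : n → ℂ) k) = 0 := by
        ext k
        by_cases hk : k = i
        · subst hk; simp [h]
        · simp [hk]
      rw [this]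
      simp
  · have hu : IsUnit U.det := Matrix.isUnit_det_of_left_inverse d.star_mul
    have hu' : IsUnit Uᴴ.det := Matrix.isUnit_det_of_left_inverse d.mul_star
    rw [Matrix.rank_mul_eq_left_of_isUnit_det _ _ hu', Matrix.rank_mul_eq_right_of_isUnit_det _ _ hu,
      Matrix.rank_diagonal]
    simp [Pi.single_apply]
  · rw [← Matrix.sum_mul, ← Matrix.mul_sum]
    have : ∑ i, Matrix.diagonal (Pi.single i (1 : ℂ)) = (1 : Matrix n n ℂ) := by
      ext j k
      rw [Matrix.sum_apply]
      by_cases h : j = k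
      · subst h; simp [Pi.single_apply]
      · simp [h]
    rw [this, Matrix.mul_one, d.mul_star]
  · have h : U * Matrix.diagonal (fun i => (ev i : ℂ)) * Uᴴ *
        (U * Matrix.diagonal (Pi.single i 1) * Uᴴ)
        = (ev i : ℂ) • (U * Matrix.diagonal (Pi.single i 1) * Uᴴ) := by
      rw [hmul, hdiag, Matrix.mul_smul, Matrix.smul_mul]
    rwa [← d.eq] at h

/-- `W** = log o - S(ρ)`, and this maximum is attained. -/
theorem isGreatest_doublingRate (hρ : IsState ρ) (ho : (Fintype.card n : ℝ) ≤ o) :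
    IsGreatest {w | ∃ (E : Measurement n) (q : Bet n),
        w = doublingRate (E.prob ρ) (fun _ => o) q}
      ((Real.logb 2 o - entropy ρ : ℝ) : EReal) := by
  constructor
  · obtain ⟨E, hE⟩ := (diagonalizes_eigenvectorUnitary hρ.1.1).exists_measurement
    obtain ⟨q, hq⟩ := exists_isProportional (E.prob_nonneg hρ) (E.sum_prob hρ)
    refine ⟨E, q, ?_⟩
    rw [hq.doublingRate_eq (E.prob_nonneg hρ) (E.sum_prob hρ)
      (pos_of_card_le (E.sum_prob hρ) ho), hE.sum_prob_mul_logb hρ, sub_eq_add_neg]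
  · rintro w ⟨E, q, rfl⟩
    refine (doublingRate_le (E.prob_nonneg hρ) (E.sum_prob hρ) ho q).trans ?_
    have := E.sum_prob_mul_logb_le hρ
    exact_mod_cast (by linarith)

theorem optQuantumRate_eq (hρ : IsState ρ) (ho : (Fintype.card n : ℝ) ≤ o) :
    optQuantumRate ρ (fun _ => o) = ((Real.logb 2 o - entropy ρ : ℝ) : EReal) := by
  have h := isGreatest_doublingRate hρ ho
  refine le_antisymm (iSup_le fun E => iSup_le fun q => h.2 ⟨E, q, rfl⟩) ?_
  obtain ⟨E, q, hq⟩ := h.1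
  rw [hq]
  exact le_iSup_of_le E (le_iSup (fun q => doublingRate (E.prob ρ) (fun _ => o) q) q)

end Measurements

/-! ### Independent repetitions -/

section Products

variable {ι β : Type*} [Fintype ι] [DecidableEq ι] [Fintype β] {p : β → ℝ}

/-- Independence: the expectation of a product factorises. The moments below come from choosing `F`
trivial outside one or two coordinates. -/
theorem sum_prod_mul_prod (p : β → ℝ) (F : ι → β → ℝ) :
    ∑ x : ι → β, (∏ k, p (x k)) * ∏ k, F k (x k) = ∏ k, ∑ y, p y * F k y := by
  rw [Fintype.prod_sum]
  simp only [Finset.prod_mul_distrib]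

theorem sum_prod_eq_one (hp : ∑ y, p y = 1) : ∑ x : ι → β, ∏ k, p (x k) = 1 := by
  have h := sum_prod_mul_prod (ι := ι) p fun _ _ => 1
  simpa [hp] using h

theorem sum_prod_mul_apply (hp : ∑ y, p y = 1) (g : β → ℝ) (k : ι) :
    ∑ x : ι → β, (∏ k, p (x k)) * g (x k) = ∑ y, p y * g y := by
  have h := sum_prod_mul_prod (ι := ι) p fun j y => if j = k then g y else 1
  simp only [Finset.prod_ite_eq', Finset.mem_univ, if_true] at h
  rw [h, Finset.prod_eq_single k]
  · simp
  · intro j _ hj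
    simp [hj, hp]
  · simp

theorem sum_prod_mul_apply_mul_apply {g : β → ℝ} (hg : ∑ y, p y * g y = 0)
    {k l : ι} (hkl : k ≠ l) :
    ∑ x : ι → β, (∏ k, p (x k)) * (g (x k) * g (x l)) = 0 := by
  have h := sum_prod_mul_prod (ι := ι) p fun j y =>
    (if j = k then g y else 1) * if j = l then g y else 1
  simp only [Finset.prod_mul_distrib, Finset.prod_ite_eq', Finset.mem_univ, if_true] at h
  rw [h]
  refine Finset.prod_eq_zero (Finset.mem_univ k) ?_
  simpa [hkl] using hg

theorem sum_prod_mul_sum (hp : ∑ y, p y = 1) (g : β → ℝ) :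
    ∑ x : ι → β, (∏ k, p (x k)) * ∑ k, g (x k) = Fintype.card ι * ∑ y, p y * g y := by
  simp only [Finset.mul_sum]
  rw [Finset.sum_comm]
  simp only [sum_prod_mul_apply hp]
  simp [Finset.mul_sum]

/-- Additivity of variance: the cross terms between different coordinates vanish because `g` is
centred. -/
theorem sum_prod_mul_sum_sq (hp : ∑ y, p y = 1) {g : β → ℝ} (hg : ∑ y, p y * g y = 0) :
    ∑ x : ι → β, (∏ k, p (x k)) * (∑ k, g (x k)) ^ 2
      = Fintype.card ι * ∑ y, p y * g y ^ 2 := by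
  have h1 : ∀ x : ι → β, (∏ k, p (x k)) * (∑ k, g (x k)) ^ 2
      = ∑ k, ∑ l, (∏ k, p (x k)) * (g (x k) * g (x l)) := by
    intro x
    rw [sq, Finset.sum_mul_sum, Finset.mul_sum]
    simp only [Finset.mul_sum]
  simp only [h1]
  rw [Finset.sum_comm]
  have h2 : ∀ k : ι, ∑ x : ι → β, ∑ l, (∏ k, p (x k)) * (g (x k) * g (x l))
      = ∑ y, p y * g y ^ 2 := by
    intro k
    rw [Finset.sum_comm, Finset.sum_eq_single k]
    · rw [← sum_prod_mul_apply hp (fun y => g y ^ 2) k]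
      simp only [sq]
    · exact fun l _ hl => sum_prod_mul_apply_mul_apply hg hl.symm
    · simp
  simp only [h2]
  simp

end Products

/-! ### Expectation, variance and concentration of the take-home wealth -/

section Histories

variable {β γ : Type*} [Fintype β] [Fintype γ] {K : ℕ} {T : Finset (Fin K)}
  {pB XB : β → ℝ} {pC XC : γ → ℝ} {WB WC : ℝ}

theorem card_mem_eq : (Fintype.card {k // k ∈ T} : ℝ) = T.card := by
  rw [Fintype.card_coe]

theorem card_notMem_eq : (Fintype.card {k // k ∉ T} : ℝ) = K - T.card := by
  have h := Fintype.card_subtype_compl (fun k => k ∈ T)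
  rw [h, Fintype.card_coe, Fintype.card_fin, Nat.cast_sub]
  simpa using T.card_le_univ

theorem card_le_real : (T.card : ℝ) ≤ K := by
  have h := T.card_le_univ
  rw [Fintype.card_fin] at h
  exact_mod_cast h

theorem historyProb_nonneg (hB : ∀ x, 0 ≤ pB x) (hC : ∀ x, 0 ≤ pC x) (ω : History β γ T) :
    0 ≤ historyProb T pB pC ω :=
  mul_nonneg (Finset.prod_nonneg fun _ _ => hB _) (Finset.prod_nonneg fun _ _ => hC _)

theorem sum_historyProb_mul_add (hB : ∑ x, pB x = 1) (hC : ∑ x, pC x = 1) (gB : β → ℝ)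
    (gC : γ → ℝ) :
    ∑ ω, historyProb T pB pC ω * (∑ k, gB (ω.1 k) + ∑ k, gC (ω.2 k))
      = T.card * (∑ x, pB x * gB x) + (K - T.card) * ∑ x, pC x * gC x := by
  rw [← card_notMem_eq, ← card_mem_eq, ← sum_prod_mul_sum hB, ← sum_prod_mul_sum hC,
    Fintype.sum_prod_type]
  have h : ∀ (x : {k // k ∈ T} → β) (y : {k // k ∉ T} → γ),
      historyProb T pB pC (x, y) * (∑ k, gB (x k) + ∑ k, gC (y k))
      = ((∏ k, pB (x k)) * ∑ k, gB (x k)) * (∏ k, pC (y k))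
        + (∏ k, pB (x k)) * ((∏ k, pC (y k)) * ∑ k, gC (y k)) := by
    intro x y
    simp only [historyProb]
    ring
  simp only [h, Finset.sum_add_distrib, ← Finset.mul_sum, ← Finset.sum_mul]
  rw [sum_prod_eq_one hB, sum_prod_eq_one hC, mul_one, one_mul]

theorem sum_historyProb (hB : ∑ x, pB x = 1) (hC : ∑ x, pC x = 1) :
    ∑ ω, historyProb T pB pC ω = 1 := by
  rw [Fintype.sum_prod_type]
  simp only [historyProb, ← Finset.mul_sum, ← Finset.sum_mul]
  rw [sum_prod_eq_one hB, sum_prod_eq_one hC, mul_one]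

theorem sum_historyProb_mul_sq (hB : ∑ x, pB x = 1) (hC : ∑ x, pC x = 1) {gB : β → ℝ}
    {gC : γ → ℝ} (hgB : ∑ x, pB x * gB x = 0) (hgC : ∑ x, pC x * gC x = 0) :
    ∑ ω, historyProb T pB pC ω * (∑ k, gB (ω.1 k) + ∑ k, gC (ω.2 k)) ^ 2
      = T.card * (∑ x, pB x * gB x ^ 2) + (K - T.card) * ∑ x, pC x * gC x ^ 2 := by
  rw [← card_notMem_eq, ← card_mem_eq, ← sum_prod_mul_sum_sq hB hgB, ← sum_prod_mul_sum_sq hC hgC,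
    Fintype.sum_prod_type]
  -- The middle term couples the two kinds of gambles and has mean zero, since both functions are
  -- centred.
  have h : ∀ (x : {k // k ∈ T} → β) (y : {k // k ∉ T} → γ),
      historyProb T pB pC (x, y) * (∑ k, gB (x k) + ∑ k, gC (y k)) ^ 2
      = ((∏ k, pB (x k)) * (∑ k, gB (x k)) ^ 2) * (∏ k, pC (y k))
        + (2 * ((∏ k, pB (x k)) * ∑ k, gB (x k))) * ((∏ k, pC (y k)) * ∑ k, gC (y k))
        + (∏ k, pB (x k)) * ((∏ k, pC (y k)) * (∑ k, gC (y k)) ^ 2) := by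
    intro x y
    simp only [historyProb]
    ring
  simp only [h, Finset.sum_add_distrib, ← Finset.mul_sum, ← Finset.sum_mul]
  rw [sum_prod_eq_one hB, sum_prod_eq_one hC, sum_prod_mul_sum hB, sum_prod_mul_sum hC, hgB, hgC]
  ring

/-- Positivity is required only for a kind of gamble that actually occurs, so that `T` may be empty
or everything. -/
theorem factors_pos_of_historyProb_pos (hB : ∀ x, 0 ≤ pB x) (hC : ∀ x, 0 ≤ pC x)
    (hXB : ∀ k ∈ T, ∀ x, 0 < pB x → 0 < XB x) (hXC : ∀ k ∉ T, ∀ x, 0 < pC x → 0 < XC x)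
    {ω : History β γ T} (hω : 0 < historyProb T pB pC ω) :
    (∀ k, 0 < XB (ω.1 k)) ∧ ∀ k, 0 < XC (ω.2 k) := by
  have h := hω.ne'
  unfold historyProb at h
  rw [mul_ne_zero_iff, Finset.prod_ne_zero_iff, Finset.prod_ne_zero_iff] at h
  exact ⟨fun k => hXB k.1 k.2 _ ((hB _).lt_of_ne' (h.1 k (Finset.mem_univ _))),
    fun k => hXC k.1 k.2 _ ((hC _).lt_of_ne' (h.2 k (Finset.mem_univ _)))⟩

theorem takeHome_pos {ω : History β γ T} (h : (∀ k, 0 < XB (ω.1 k)) ∧ ∀ k, 0 < XC (ω.2 k)) :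
    0 < takeHome T XB XC WB WC ω :=
  mul_pos (Real.rpow_pos_of_pos two_pos _)
    (mul_pos (Finset.prod_pos fun k _ => h.1 k) (Finset.prod_pos fun k _ => h.2 k))

theorem logb_takeHome {ω : History β γ T} (h : (∀ k, 0 < XB (ω.1 k)) ∧ ∀ k, 0 < XC (ω.2 k)) :
    Real.logb 2 (takeHome T XB XC WB WC ω)
      = -((T.card : ℝ) * WB + ((K : ℝ) - T.card) * WC)
        + (∑ k, Real.logb 2 (XB (ω.1 k)) + ∑ k, Real.logb 2 (XC (ω.2 k))) := by
  have h1 := Finset.prod_pos fun k (_ : k ∈ Finset.univ) => h.1 k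
  have h2 := Finset.prod_pos fun k (_ : k ∈ Finset.univ) => h.2 k
  have hlog : ∀ {ι : Type} (s : Finset ι) (f : ι → ℝ), (∀ k, 0 < f k) →
      Real.logb 2 (∏ k ∈ s, f k) = ∑ k ∈ s, Real.logb 2 (f k) := fun s f hf =>
    Real.logb_prod _ _ fun k _ => (hf k).ne'
  rw [takeHome, Real.logb_mul (Real.rpow_pos_of_pos two_pos _).ne' (mul_pos h1 h2).ne',
    Real.logb_rpow two_pos (by norm_num), Real.logb_mul h1.ne' h2.ne', hlog _ _ h.1, hlog _ _ h.2]

theorem takeHomeRate_eq (hB : ∀ x, 0 ≤ pB x) (hC : ∀ x, 0 ≤ pC x) (hB1 : ∑ x, pB x = 1)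
    (hC1 : ∑ x, pC x = 1) (hXB : ∀ k ∈ T, ∀ x, 0 < pB x → 0 < XB x)
    (hXC : ∀ k ∉ T, ∀ x, 0 < pC x → 0 < XC x) :
    takeHomeRate T pB pC XB XC WB WC =
      ((((T.card : ℝ) * (∑ x, pB x * Real.logb 2 (XB x) - WB)
        + (K - T.card) * (∑ x, pC x * Real.logb 2 (XC x) - WC)) / K : ℝ) : EReal) := by
  unfold takeHomeRate
  have hpos := fun (ω : History β γ T) (hω : 0 < historyProb T pB pC ω) =>
    factors_pos_of_historyProb_pos hB hC hXB hXC hω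
  rw [sum_mul_log2_of_pos (historyProb_nonneg hB hC) fun ω hω => takeHome_pos (hpos ω hω),
    ← EReal.coe_div]
  congr 2
  have h1 : ∀ ω : History β γ T,
      historyProb T pB pC ω * Real.logb 2 (takeHome T XB XC WB WC ω)
        = historyProb T pB pC ω * (-((T.card : ℝ) * WB + ((K : ℝ) - T.card) * WC))
          + historyProb T pB pC ω *
            (∑ k, Real.logb 2 (XB (ω.1 k)) + ∑ k, Real.logb 2 (XC (ω.2 k))) := by
    intro ω
    rcases (historyProb_nonneg hB hC ω).eq_or_lt with h0 | h0
    · simp [← h0]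
    · rw [logb_takeHome (hpos ω h0), mul_add]
  simp only [h1, Finset.sum_add_distrib, ← Finset.sum_mul]
  rw [sum_historyProb hB1 hC1, sum_historyProb_mul_add hB1 hC1 (fun x => Real.logb 2 (XB x))
    fun x => Real.logb 2 (XC x)]
  ring

theorem takeHomeRate_eq_bot (hK : 0 < K) {ω : History β γ T} (hω : 0 < historyProb T pB pC ω)
    (h : takeHome T XB XC WB WC ω ≤ 0) : takeHomeRate T pB pC XB XC WB WC = ⊥ := by
  unfold takeHomeRate
  rw [sum_mul_log2_eq_bot hω h.not_gt]
  exact EReal.bot_div_of_pos_ne_top (by exact_mod_cast hK) (EReal.coe_ne_top _)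

theorem exists_pos_of_sum_eq_one {p : β → ℝ} (hp : ∑ x, p x = 1) :
    ∃ x, 0 < p x := by
  by_contra! h
  linarith [Finset.sum_nonpos fun x (_ : x ∈ Finset.univ) => h x]

theorem factors_pos_of_takeHomeRate_ne_bot (hK : 0 < K) (hB1 : ∑ x, pB x = 1)
    (hC1 : ∑ x, pC x = 1) (hXB : ∀ x, 0 ≤ XB x) (hXC : ∀ x, 0 ≤ XC x)
    (h : takeHomeRate T pB pC XB XC WB WC ≠ ⊥) :
    (∀ k ∈ T, ∀ x, 0 < pB x → 0 < XB x) ∧ ∀ k ∉ T, ∀ x, 0 < pC x → 0 < XC x := by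
  constructor
  · intro k hk x hx
    refine (hXB x).lt_of_ne' fun h0 => h ?_
    obtain ⟨y, hy⟩ := exists_pos_of_sum_eq_one hC1
    -- A constant history has positive probability and contains the ruinous outcome `x` at gamble
    -- `k`.
    refine takeHomeRate_eq_bot hK (ω := (fun _ => x, fun _ => y))
      (mul_pos (Finset.prod_pos fun _ _ => hx) (Finset.prod_pos fun _ _ => hy)) (le_of_eq ?_)
    have : ∏ _k : {k // k ∈ T}, XB x = 0 :=
      Finset.prod_eq_zero (Finset.mem_univ (⟨k, hk⟩ : {k // k ∈ T})) h0
    simp only [takeHome, this, zero_mul, mul_zero]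
  · intro k hk y hy
    refine (hXC y).lt_of_ne' fun h0 => h ?_
    obtain ⟨x, hx⟩ := exists_pos_of_sum_eq_one hB1
    refine takeHomeRate_eq_bot hK (ω := (fun _ => x, fun _ => y))
      (mul_pos (Finset.prod_pos fun _ _ => hx) (Finset.prod_pos fun _ _ => hy)) (le_of_eq ?_)
    have : ∏ _k : {k // k ∉ T}, XC y = 0 :=
      Finset.prod_eq_zero (Finset.mem_univ (⟨k, hk⟩ : {k // k ∉ T})) h0
    simp only [takeHome, this, mul_zero]

/-- Upper bounds on the doubling rates of the single gambles bound the take-home rate. -/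
theorem takeHomeRate_le (hK : 0 < K) (hB : ∀ x, 0 ≤ pB x) (hC : ∀ x, 0 ≤ pC x)
    (hB1 : ∑ x, pB x = 1) (hC1 : ∑ x, pC x = 1) (hXB : ∀ x, 0 ≤ XB x) (hXC : ∀ x, 0 ≤ XC x)
    {MB MC : ℝ}
    (hMB : (∀ x, 0 < pB x → 0 < XB x) → ∑ x, pB x * Real.logb 2 (XB x) ≤ MB)
    (hMC : (∀ x, 0 < pC x → 0 < XC x) → ∑ x, pC x * Real.logb 2 (XC x) ≤ MC) :
    takeHomeRate T pB pC XB XC WB WC ≤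
      ((((T.card : ℝ) * (MB - WB) + (K - T.card) * (MC - WC)) / K : ℝ) : EReal) := by
  by_cases h : takeHomeRate T pB pC XB XC WB WC = ⊥
  · rw [h]
    exact bot_le
  obtain ⟨h1, h2⟩ := factors_pos_of_takeHomeRate_ne_bot hK hB1 hC1 hXB hXC h
  rw [takeHomeRate_eq hB hC hB1 hC1 h1 h2, EReal.coe_le_coe_iff]
  refine div_le_div_of_nonneg_right (add_le_add ?_ ?_) (Nat.cast_nonneg K)
  -- If no gamble is of this kind, `hMB` may be unavailable, but its coefficient is zero.
  · rcases T.eq_empty_or_nonempty with h0 | ⟨k, hk⟩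
    · simp [h0]
    · exact mul_le_mul_of_nonneg_left (sub_le_sub_right (hMB (h1 k hk)) _) (Nat.cast_nonneg _)
  · by_cases h0 : ∃ k, k ∉ T
    · obtain ⟨k, hk⟩ := h0
      exact mul_le_mul_of_nonneg_left (sub_le_sub_right (hMC (h2 k hk)) _)
        (sub_nonneg.2 card_le_real)
    · push Not at h0
      have : T = Finset.univ := Finset.eq_univ_iff_forall.2 h0
      simp [this]

/-- Chebyshev's inequality for the logarithm of the take-home wealth. -/
theorem one_sub_le_takeHomeProb (hK : 0 < K) (hB : ∀ x, 0 ≤ pB x) (hC : ∀ x, 0 ≤ pC x)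
    (hB1 : ∑ x, pB x = 1) (hC1 : ∑ x, pC x = 1) (hXB : ∀ k ∈ T, ∀ x, 0 < pB x → 0 < XB x)
    (hXC : ∀ k ∉ T, ∀ x, 0 < pC x → 0 < XC x) {w ε mB mC : ℝ} (hε : 0 < ε)
    (hmB : ∑ x, pB x * Real.logb 2 (XB x) = mB) (hmC : ∑ x, pC x * Real.logb 2 (XC x) = mC)
    (hw : K * w = T.card * (mB - WB) + (K - T.card) * (mC - WC)) :
    1 - (∑ x, pB x * (Real.logb 2 (XB x) - mB) ^ 2
        + ∑ x, pC x * (Real.logb 2 (XC x) - mC) ^ 2) / (K * ε ^ 2)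
      ≤ takeHomeProb T pB pC XB XC WB WC
          (Set.Icc ((2 : ℝ) ^ (K * (w - ε))) ((2 : ℝ) ^ (K * (w + ε)))) := by
  set I := Set.Icc ((2 : ℝ) ^ (K * (w - ε))) ((2 : ℝ) ^ (K * (w + ε)))
  set D : History β γ T → ℝ := fun ω => ∑ k, (Real.logb 2 (XB (ω.1 k)) - mB)
    + ∑ k, (Real.logb 2 (XC (ω.2 k)) - mC) with hD
  have hK' : (0 : ℝ) < K := by exact_mod_cast hK
  -- Chebyshev, one history at a time: outside the interval the squared deviation is at least `(K *
  -- ε) ^ 2`, so the left side is nonpositive.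
  have hterm : ∀ ω : History β γ T,
      historyProb T pB pC ω - historyProb T pB pC ω * D ω ^ 2 / (K * ε) ^ 2
        ≤ {ω | takeHome T XB XC WB WC ω ∈ I}.indicator (historyProb T pB pC) ω := by
    intro ω
    have h0 := historyProb_nonneg hB hC ω
    by_cases hI : takeHome T XB XC WB WC ω ∈ I
    · rw [Set.indicator_of_mem (by exact hI)]
      have : 0 ≤ historyProb T pB pC ω * D ω ^ 2 / (K * ε) ^ 2 := by positivity
      linarith
    · rw [Set.indicator_of_notMem (by exact hI)]
      rcases h0.eq_or_lt with h0 | h0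
      · simp [← h0]
      have hpos := factors_pos_of_historyProb_pos hB hC hXB hXC h0
      have hlog : Real.logb 2 (takeHome T XB XC WB WC ω) = K * w + D ω := by
        rw [logb_takeHome hpos, hw, hD]
        simp only [Finset.sum_sub_distrib, Finset.sum_const, Finset.card_univ, nsmul_eq_mul,
          card_notMem_eq, card_mem_eq]
        ring
      have hge : (K * ε) ^ 2 ≤ D ω ^ 2 := by
        by_contra! hlt
        have hKε : 0 ≤ K * ε := by positivity
        obtain ⟨h1, h2⟩ := abs_lt.1 (abs_lt_of_sq_lt_sq hlt hKε)
        refine hI ⟨?_, ?_⟩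
        · rw [← Real.le_logb_iff_rpow_le one_lt_two (takeHome_pos hpos), hlog]
          linarith
        · rw [← Real.logb_le_iff_le_rpow one_lt_two (takeHome_pos hpos), hlog]
          linarith
      have : historyProb T pB pC ω ≤ historyProb T pB pC ω * D ω ^ 2 / (K * ε) ^ 2 := by
        rw [le_div_iff₀ (by positivity)]
        exact mul_le_mul_of_nonneg_left hge h0.le
      linarith
  have hzB : ∑ x, pB x * (Real.logb 2 (XB x) - mB) = 0 := by
    simp only [mul_sub, Finset.sum_sub_distrib, ← Finset.sum_mul, hB1, hmB]
    ring
  have hzC : ∑ x, pC x * (Real.logb 2 (XC x) - mC) = 0 := by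
    simp only [mul_sub, Finset.sum_sub_distrib, ← Finset.sum_mul, hC1, hmC]
    ring
  refine le_trans ?_ (Finset.sum_le_sum fun ω _ => hterm ω)
  rw [Finset.sum_sub_distrib, sum_historyProb hB1 hC1, ← Finset.sum_div,
    sum_historyProb_mul_sq hB1 hC1 hzB hzC]
  have hVB : 0 ≤ ∑ x, pB x * (Real.logb 2 (XB x) - mB) ^ 2 :=
    Finset.sum_nonneg fun x _ => mul_nonneg (hB x) (sq_nonneg _)
  have hVC : 0 ≤ ∑ x, pC x * (Real.logb 2 (XC x) - mC) ^ 2 :=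
    Finset.sum_nonneg fun x _ => mul_nonneg (hC x) (sq_nonneg _)
  refine sub_le_sub_left ?_ 1
  rw [div_le_div_iff₀ (by positivity) (by positivity)]
  -- Both counts are at most `K`, which makes the variance bound independent of `T`.
  have h1 := mul_le_mul_of_nonneg_right (card_le_real (T := T)) hVB
  have h2 : ((K : ℝ) - T.card) * ∑ x, pC x * (Real.logb 2 (XC x) - mC) ^ 2
      ≤ K * ∑ x, pC x * (Real.logb 2 (XC x) - mC) ^ 2 :=
    mul_le_mul_of_nonneg_right (by linarith [Nat.cast_nonneg (α := ℝ) T.card]) hVC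
  calc _ ≤ (K * (∑ x, pB x * (Real.logb 2 (XB x) - mB) ^ 2
        + ∑ x, pC x * (Real.logb 2 (XC x) - mC) ^ 2)) * (K * ε ^ 2) :=
        mul_le_mul_of_nonneg_right (by linarith) (by positivity)
    _ = _ := by ring

end Histories

/-! ### The quantum game -/

section QuantumGame

variable {a b c : Type*} [Fintype a] [DecidableEq a] [Fintype b] [DecidableEq b]
  [Fintype c] [DecidableEq c] {ρ : Matrix (a × b × c) (a × b × c) ℂ} {o : ℝ} {K : ℕ}
  {T : Finset (Fin K)}

theorem card_prod_le {m n : Type*} [Fintype m] [Fintype n] (hm : (Fintype.card m : ℝ) ≤ o)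
    (hn : (Fintype.card n : ℝ) ≤ o) : (Fintype.card (m × n) : ℝ) ≤ o * o := by
  rw [Fintype.card_prod, Nat.cast_mul]
  exact mul_le_mul hm hn (Nat.cast_nonneg _) ((Nat.cast_nonneg _).trans hm)

theorem rate_value {f L SAB SB SAC SC : ℝ} (hK : 0 < K) (hf : (T.card : ℝ) = f * K) :
    ((T.card : ℝ) * (L + L - SAB - (L - SB)) + (K - T.card) * (L + L - SAC - (L - SC))) / K
      = L - f * (SAB - SB) - (1 - f) * (SAC - SC) := by
  have hK' : (K : ℝ) ≠ 0 := by exact_mod_cast hK.ne'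
  rw [hf]
  field_simp
  ring

theorem Strategy.rate_eq_takeHomeRate (σ : Strategy a b c) (hρ : IsState ρ)
    (hoB : (Fintype.card b : ℝ) ≤ o) (hoC : (Fintype.card c : ℝ) ≤ o) (T : Finset (Fin K)) :
    σ.rate ρ (fun _ => o) (fun _ => o) (fun _ => o) T =
      takeHomeRate T (σ.measAB.prob (reduceAB ρ)) (σ.measAC.prob (reduceAC ρ))
        (σ.betAB.factor fun _ => o * o) (σ.betAC.factor fun _ => o * o)
        (Real.logb 2 o - entropy (traceFst (reduceAB ρ)))
        (Real.logb 2 o - entropy (traceFst (reduceAC ρ))) := by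
  unfold Strategy.rate
  rw [optQuantumRate_eq hρ.reduceAB.traceFst hoB, optQuantumRate_eq hρ.reduceAC.traceFst hoC,
    EReal.toReal_coe, EReal.toReal_coe]
  rfl

theorem Strategy.growthProb_eq_takeHomeProb (σ : Strategy a b c) (hρ : IsState ρ)
    (hoB : (Fintype.card b : ℝ) ≤ o) (hoC : (Fintype.card c : ℝ) ≤ o) (T : Finset (Fin K))
    (I : Set ℝ) :
    σ.growthProb ρ (fun _ => o) (fun _ => o) (fun _ => o) T I =
      takeHomeProb T (σ.measAB.prob (reduceAB ρ)) (σ.measAC.prob (reduceAC ρ))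
        (σ.betAB.factor fun _ => o * o) (σ.betAC.factor fun _ => o * o)
        (Real.logb 2 o - entropy (traceFst (reduceAB ρ)))
        (Real.logb 2 o - entropy (traceFst (reduceAC ρ))) I := by
  unfold Strategy.growthProb
  rw [optQuantumRate_eq hρ.reduceAB.traceFst hoB, optQuantumRate_eq hρ.reduceAC.traceFst hoC,
    EReal.toReal_coe, EReal.toReal_coe]
  rfl

theorem Strategy.rate_le (σ : Strategy a b c) (hρ : IsState ρ) (hoA : (Fintype.card a : ℝ) ≤ o)
    (hoB : (Fintype.card b : ℝ) ≤ o) (hoC : (Fintype.card c : ℝ) ≤ o) (hK : 0 < K) {f : ℝ}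
    (hf : (T.card : ℝ) = f * K) :
    σ.rate ρ (fun _ => o) (fun _ => o) (fun _ => o) T ≤
      ((Real.logb 2 o - f * condEntropy (reduceAB ρ)
        - (1 - f) * condEntropy (reduceAC ρ) : ℝ) : EReal) := by
  have ho0 : 0 ≤ o := (Nat.cast_nonneg _).trans hoA
  have ho : Real.logb 2 (o * o) = Real.logb 2 o + Real.logb 2 o := by
    rcases ho0.eq_or_lt with h | h
    · simp [← h]
    · exact Real.logb_mul h.ne' h.ne'
  have hAB := hρ.reduceAB
  have hAC := hρ.reduceAC
  rw [σ.rate_eq_takeHomeRate hρ hoB hoC]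
  refine (takeHomeRate_le (MB := Real.logb 2 o + Real.logb 2 o - entropy (reduceAB ρ))
    (MC := Real.logb 2 o + Real.logb 2 o - entropy (reduceAC ρ)) hK
    (σ.measAB.prob_nonneg hAB) (σ.measAC.prob_nonneg hAC)
    (σ.measAB.sum_prob hAB) (σ.measAC.sum_prob hAC)
    (σ.betAB.factor_nonneg fun _ => mul_nonneg ho0 ho0)
    (σ.betAC.factor_nonneg fun _ => mul_nonneg ho0 ho0) (fun h => ?_) fun h => ?_).trans
    (EReal.coe_le_coe_iff.2 (rate_value hK hf).le)
  · have h1 := sum_mul_logb_factor_le (σ.measAB.prob_nonneg hAB) (σ.measAB.sum_prob hAB)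
      (card_prod_le hoA hoB) σ.betAB h
    linarith [σ.measAB.sum_prob_mul_logb_le hAB]
  · have h1 := sum_mul_logb_factor_le (σ.measAC.prob_nonneg hAC) (σ.measAC.sum_prob hAC)
      (card_prod_le hoA hoC) σ.betAC h
    linarith [σ.measAC.sum_prob_mul_logb_le hAC]

theorem Strategy.IsEigenProportional.rate_eq {σ : Strategy a b c} (hσ : σ.IsEigenProportional ρ)
    (hρ : IsState ρ) (hoB : (Fintype.card b : ℝ) ≤ o) (hoC : (Fintype.card c : ℝ) ≤ o)
    (hK : 0 < K) {f : ℝ} (hf : (T.card : ℝ) = f * K) :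
    σ.rate ρ (fun _ => o) (fun _ => o) (fun _ => o) T =
      ((Real.logb 2 o - f * condEntropy (reduceAB ρ)
        - (1 - f) * condEntropy (reduceAC ρ) : ℝ) : EReal) := by
  obtain ⟨hE, hq, hE', hq'⟩ := hσ
  have hAB := hρ.reduceAB
  have hAC := hρ.reduceAC
  -- Unit trace forces a nonempty index type, hence `o ≥ 1`.
  have ho0 : 0 < o := by
    obtain ⟨E, -⟩ := (diagonalizes_eigenvectorUnitary hAB.traceFst.1.1).exists_measurement
    exact pos_of_card_le (E.sum_prob hAB.traceFst) hoB
  rw [σ.rate_eq_takeHomeRate hρ hoB hoC,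
    takeHomeRate_eq (σ.measAB.prob_nonneg hAB) (σ.measAC.prob_nonneg hAC)
      (σ.measAB.sum_prob hAB) (σ.measAC.sum_prob hAC)
      (fun _ _ => hq.factor_pos (mul_pos ho0 ho0)) (fun _ _ => hq'.factor_pos (mul_pos ho0 ho0)),
    hq.sum_mul_logb (σ.measAB.sum_prob hAB) (mul_pos ho0 ho0),
    hq'.sum_mul_logb (σ.measAC.sum_prob hAC) (mul_pos ho0 ho0), hE.sum_prob_mul_logb hAB,
    hE'.sum_prob_mul_logb hAC, Real.logb_mul ho0.ne' ho0.ne', ← sub_eq_add_neg, ← sub_eq_add_neg,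
    rate_value hK hf]
  rfl

theorem exists_isEigenProportional (hρ : IsState ρ) :
    ∃ σ : Strategy a b c, σ.IsEigenProportional ρ := by
  have hAB := hρ.reduceAB
  have hAC := hρ.reduceAC
  obtain ⟨E, hE⟩ := (diagonalizes_eigenvectorUnitary hAB.1.1).exists_measurement
  obtain ⟨q, hq⟩ := exists_isProportional (E.prob_nonneg hAB) (E.sum_prob hAB)
  obtain ⟨E', hE'⟩ := (diagonalizes_eigenvectorUnitary hAC.1.1).exists_measurement
  obtain ⟨q', hq'⟩ := exists_isProportional (E'.prob_nonneg hAC) (E'.sum_prob hAC)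
  exact ⟨⟨E, q, E', q'⟩, hE, hq, hE', hq'⟩

/-- The weak law of large numbers for the take-home wealth. -/
theorem Strategy.exists_growthProb_gt (σ : Strategy a b c) (hρ : IsState ρ)
    (hoB : (Fintype.card b : ℝ) ≤ o) (hoC : (Fintype.card c : ℝ) ≤ o) (w : ℝ) {ε δ : ℝ}
    (hε : 0 < ε) (hδ : 0 < δ) :
    ∃ K₀ : ℕ, ∀ (K : ℕ) (_ : K₀ ≤ K) (T : Finset (Fin K)),
      σ.rate ρ (fun _ => o) (fun _ => o) (fun _ => o) T = (w : EReal) →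
      1 - δ < σ.growthProb ρ (fun _ => o) (fun _ => o) (fun _ => o) T
        (Set.Icc ((2 : ℝ) ^ (K * (w - ε))) ((2 : ℝ) ^ (K * (w + ε)))) := by
  have hAB := hρ.reduceAB
  have hAC := hρ.reduceAC
  have ho0 : 0 ≤ o := (Nat.cast_nonneg _).trans hoB
  set pB := σ.measAB.prob (reduceAB ρ)
  set pC := σ.measAC.prob (reduceAC ρ)
  set XB := σ.betAB.factor fun _ => o * o
  set XC := σ.betAC.factor fun _ => o * o
  -- If a factor vanishes on an outcome of positive probability, `mB` uses the default `Real.logb 2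
  -- 0 = 0`. A finite rate then forces `T` to be empty, so this mean has coefficient zero; likewise
  -- for `mC` when `T` is everything.
  obtain ⟨mB, hmB⟩ : ∃ mB, ∑ x, pB x * Real.logb 2 (XB x) = mB := ⟨_, rfl⟩
  obtain ⟨mC, hmC⟩ : ∃ mC, ∑ x, pC x * Real.logb 2 (XC x) = mC := ⟨_, rfl⟩
  obtain ⟨V, hV⟩ : ∃ V, ∑ x, pB x * (Real.logb 2 (XB x) - mB) ^ 2
      + ∑ x, pC x * (Real.logb 2 (XC x) - mC) ^ 2 = V := ⟨_, rfl⟩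
  -- Chosen so that `V / (K * ε ^ 2) < δ` for `K ≥ N`; the threshold `N + 1` also ensures `K > 0`.
  -- As `V` does not involve `T`, the threshold is uniform.
  obtain ⟨N, hN⟩ := exists_nat_gt (V / (ε ^ 2 * δ))
  refine ⟨N + 1, fun K hK T hw => ?_⟩
  have hK0 : 0 < K := by omega
  have hK' : (0 : ℝ) < K := by exact_mod_cast hK0
  have hNK : (N : ℝ) ≤ K := by exact_mod_cast (by omega : N ≤ K)
  rw [σ.rate_eq_takeHomeRate hρ hoB hoC] at hw
  rw [σ.growthProb_eq_takeHomeProb hρ hoB hoC]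
  have hB := σ.measAB.prob_nonneg hAB
  have hC := σ.measAC.prob_nonneg hAC
  have hB1 := σ.measAB.sum_prob hAB
  have hC1 := σ.measAC.sum_prob hAC
  obtain ⟨h1, h2⟩ := factors_pos_of_takeHomeRate_ne_bot hK0 hB1 hC1
    (σ.betAB.factor_nonneg fun _ => mul_nonneg ho0 ho0)
    (σ.betAC.factor_nonneg fun _ => mul_nonneg ho0 ho0) (by rw [hw]; exact EReal.coe_ne_bot _)
  rw [takeHomeRate_eq hB hC hB1 hC1 h1 h2, EReal.coe_eq_coe_iff, div_eq_iff hK'.ne'] at hw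
  refine lt_of_lt_of_le ?_ (one_sub_le_takeHomeProb hK0 hB hC hB1 hC1 h1 h2 hε hmB hmC
    (by rw [← hmB, ← hmC, mul_comm, ← hw]))
  rw [hV]
  refine sub_lt_sub_left ?_ 1
  rw [div_lt_iff₀ (by positivity)]
  rw [div_lt_iff₀ (by positivity)] at hN
  have := mul_le_mul_of_nonneg_right hNK (by positivity : 0 ≤ ε ^ 2 * δ)
  linarith

end QuantumGame

/-! ### The classical game -/

section ClassicalGame

variable {a b c : Type*} [Fintype a] [Fintype b] [Fintype c] {o : ℝ} {K : ℕ} {T : Finset (Fin K)}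

/-- The Shannon entropy of a pair is at least that of its second component. -/
theorem sum_mul_logb_le_marginal {m n : Type*} [Fintype m] [Fintype n] {r : m × n → ℝ}
    (hr : ∀ x, 0 ≤ r x) :
    ∑ x, r x * Real.logb 2 (r x) ≤ ∑ j, (∑ i, r (i, j)) * Real.logb 2 (∑ i, r (i, j)) := by
  rw [Fintype.sum_prod_type_right]
  refine Finset.sum_le_sum fun j _ => ?_
  rw [Finset.sum_mul]
  refine Finset.sum_le_sum fun i _ => ?_
  rcases (hr (i, j)).eq_or_lt with h0 | h0
  · simp [← h0]
  · refine mul_le_mul_of_nonneg_left (Real.logb_le_logb_of_le one_lt_two h0 ?_) h0.le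
    exact Finset.single_le_sum (f := fun i => r (i, j)) (fun i _ => hr _) (Finset.mem_univ i)

theorem classicalRate_eq_takeHomeRate {p : a × b × c → ℝ} (hp : p ∈ stdSimplex ℝ (a × b × c))
    (hoB : (Fintype.card b : ℝ) ≤ o) (hoC : (Fintype.card c : ℝ) ≤ o) (qAB : Bet (a × b))
    (qAC : Bet (a × c)) :
    classicalRate p qAB qAC (fun _ => o) (fun _ => o) (fun _ => o) T =
      takeHomeRate T (fun x : a × b => ∑ k, p (x.1, x.2, k))
        (fun x : a × c => ∑ j, p (x.1, j, x.2))
        (qAB.factor fun _ => o * o) (qAC.factor fun _ => o * o)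
        (Real.logb 2 o + ∑ j, (∑ i, ∑ k, p (i, j, k)) * Real.logb 2 (∑ i, ∑ k, p (i, j, k)))
        (Real.logb 2 o + ∑ k, (∑ i, ∑ j, p (i, j, k)) * Real.logb 2 (∑ i, ∑ j, p (i, j, k))) := by
  have hp1 := hp.2
  have hB1 : ∑ j, ∑ i, ∑ k, p (i, j, k) = 1 := by
    rw [← hp1, Fintype.sum_prod_type, Finset.sum_comm]
    simp only [Fintype.sum_prod_type]
  have hC1 : ∑ k, ∑ i, ∑ j, p (i, j, k) = 1 := by
    rw [← hp1, Fintype.sum_prod_type, Finset.sum_comm]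
    simp only [Fintype.sum_prod_type_right]
  unfold classicalRate
  rw [optRate_eq (fun j => Finset.sum_nonneg fun i _ => Finset.sum_nonneg fun k _ => hp.1 _) hB1
      hoB,
    optRate_eq (fun j => Finset.sum_nonneg fun i _ => Finset.sum_nonneg fun k _ => hp.1 _) hC1 hoC,
    EReal.toReal_coe, EReal.toReal_coe]
  rfl

theorem sum_marginalAB {p : a × b × c → ℝ} (hp : p ∈ stdSimplex ℝ (a × b × c)) :
    ∑ x : a × b, ∑ k, p (x.1, x.2, k) = 1 := by
  rw [← hp.2]
  simp only [Fintype.sum_prod_type]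

theorem sum_marginalAC {p : a × b × c → ℝ} (hp : p ∈ stdSimplex ℝ (a × b × c)) :
    ∑ x : a × c, ∑ j, p (x.1, j, x.2) = 1 := by
  rw [← hp.2]
  simp only [Fintype.sum_prod_type]
  exact Finset.sum_congr rfl fun i _ => Finset.sum_comm

theorem classicalRate_le {p : a × b × c → ℝ} (hp : p ∈ stdSimplex ℝ (a × b × c))
    (hoA : (Fintype.card a : ℝ) ≤ o) (hoB : (Fintype.card b : ℝ) ≤ o)
    (hoC : (Fintype.card c : ℝ) ≤ o) (hK : 0 < K) (qAB : Bet (a × b)) (qAC : Bet (a × c)) :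
    classicalRate p qAB qAC (fun _ => o) (fun _ => o) (fun _ => o) T ≤ (Real.logb 2 o : EReal) := by
  have hB : ∀ x : a × b, 0 ≤ ∑ k, p (x.1, x.2, k) := fun x => Finset.sum_nonneg fun k _ => hp.1 _
  have hC : ∀ x : a × c, 0 ≤ ∑ j, p (x.1, j, x.2) := fun x => Finset.sum_nonneg fun k _ => hp.1 _
  have hB1 := sum_marginalAB hp
  have hC1 := sum_marginalAC hp
  have ho0 : 0 ≤ o := (Nat.cast_nonneg _).trans hoB
  have hlog : Real.logb 2 (o * o) = Real.logb 2 o + Real.logb 2 o := by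
    rcases ho0.eq_or_lt with h | h
    · simp [← h]
    · exact Real.logb_mul h.ne' h.ne'
  rw [classicalRate_eq_takeHomeRate hp hoB hoC]
  refine (takeHomeRate_le hK hB hC hB1 hC1
    (qAB.factor_nonneg fun _ => mul_nonneg ho0 ho0)
    (qAC.factor_nonneg fun _ => mul_nonneg ho0 ho0)
    (fun h => sum_mul_logb_factor_le hB hB1 (card_prod_le hoA hoB) qAB h)
    (fun h => sum_mul_logb_factor_le hC hC1 (card_prod_le hoA hoC) qAC h)).trans
    (EReal.coe_le_coe_iff.2 ?_)
  -- Classical conditional entropies are nonnegative, so each kind of gamble separately contributes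
  -- at most `log o`.
  have h1 := sum_mul_logb_le_marginal hB
  have h2 := sum_mul_logb_le_marginal hC
  rw [div_le_iff₀ (by exact_mod_cast hK), hlog]
  have hT := card_le_real (T := T)
  calc _ ≤ (T.card : ℝ) * Real.logb 2 o + (K - T.card) * Real.logb 2 o :=
        add_le_add (mul_le_mul_of_nonneg_left (by linarith) (Nat.cast_nonneg _))
          (mul_le_mul_of_nonneg_left (by linarith) (by linarith))
    _ = _ := by ring

/-- Deterministic outcomes and proportional bets achieve the rate `log o`. -/
theorem exists_classicalRate_eq [Nonempty (a × b × c)] (hoB : (Fintype.card b : ℝ) ≤ o)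
    (hoC : (Fintype.card c : ℝ) ≤ o) (hK : 0 < K) :
    ∃ (p : a × b × c → ℝ) (_ : p ∈ stdSimplex ℝ (a × b × c)) (qAB : Bet (a × b))
      (qAC : Bet (a × c)),
      (Real.logb 2 o : EReal) = classicalRate p qAB qAC (fun _ => o) (fun _ => o) (fun _ => o) T := by
  classical
  obtain ⟨i₀, j₀, k₀⟩ := Classical.arbitrary (a × b × c)
  -- For a point mass all the entropies vanish: each gamble earns `2 log o` and Bob is owed `log o`.
  have hp : Pi.single (i₀, j₀, k₀) 1 ∈ stdSimplex ℝ (a × b × c) := single_mem_stdSimplex ℝ _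
  have hB : ∀ x : a × b, 0 ≤ ∑ k, (Pi.single (i₀, j₀, k₀) 1 : a × b × c → ℝ) (x.1, x.2, k) :=
    fun x => Finset.sum_nonneg fun k _ => hp.1 _
  have hC : ∀ x : a × c, 0 ≤ ∑ j, (Pi.single (i₀, j₀, k₀) 1 : a × b × c → ℝ) (x.1, j, x.2) :=
    fun x => Finset.sum_nonneg fun k _ => hp.1 _
  obtain ⟨q, hq⟩ := exists_isProportional hB (sum_marginalAB hp)
  obtain ⟨q', hq'⟩ := exists_isProportional hC (sum_marginalAC hp)
  refine ⟨_, hp, q, q', ?_⟩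
  have ho0 : 0 < o := lt_of_lt_of_le (by exact_mod_cast Fintype.card_pos_iff.2 ⟨j₀⟩) hoB
  have hK' : (K : ℝ) ≠ 0 := by exact_mod_cast hK.ne'
  rw [classicalRate_eq_takeHomeRate hp hoB hoC,
    takeHomeRate_eq hB hC (sum_marginalAB hp) (sum_marginalAC hp)
      (fun _ _ => hq.factor_pos (mul_pos ho0 ho0)) (fun _ _ => hq'.factor_pos (mul_pos ho0 ho0)),
    hq.sum_mul_logb (sum_marginalAB hp) (mul_pos ho0 ho0),
    hq'.sum_mul_logb (sum_marginalAC hp) (mul_pos ho0 ho0), Real.logb_mul ho0.ne' ho0.ne',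
    EReal.coe_eq_coe_iff, eq_div_iff hK']
  simp [Pi.single_apply, Prod.mk.injEq, ite_and, Fintype.sum_prod_type]
  ring

end ClassicalGame

end QuantumGambling

theorem mainTheorem6 {a b c : Type*} [Fintype a] [DecidableEq a] [Fintype b] [DecidableEq b]
    [Fintype c] [DecidableEq c]
    (ρ : Matrix (a × b × c) (a × b × c) ℂ) (hρ : IsState ρ) (o : ℝ)
    (hoA : (Fintype.card a : ℝ) ≤ o) (hoB : (Fintype.card b : ℝ) ≤ o)
    (hoC : (Fintype.card c : ℝ) ≤ o) :
    -- the optimum rates for `B` alone and `C` alone, from which Bob's share is computed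
    IsGreatest {w | ∃ (E : Measurement b) (q : Bet b),
        w = doublingRate (E.prob (traceFst (reduceAB ρ))) (fun _ => o) q}
      ((Real.logb 2 o - entropy (traceFst (reduceAB ρ)) : ℝ) : EReal) ∧
    IsGreatest {w | ∃ (E : Measurement c) (q : Bet c),
        w = doublingRate (E.prob (traceFst (reduceAC ρ))) (fun _ => o) q}
      ((Real.logb 2 o - entropy (traceFst (reduceAC ρ)) : ℝ) : EReal) ∧
    -- the optimum doubling rate when Bob holds `B` in `f * K` of the `K` gambles
    (∀ (K : ℕ) (_ : 0 < K) (T : Finset (Fin K)) (f : ℝ) (_ : (T.card : ℝ) = f * K),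
      IsGreatest {w | ∃ σ : Strategy a b c,
          w = σ.rate ρ (fun _ => o) (fun _ => o) (fun _ => o) T}
        ((Real.logb 2 o - f * condEntropy (reduceAB ρ)
          - (1 - f) * condEntropy (reduceAC ρ) : ℝ) : EReal) ∧
      ∀ σ : Strategy a b c, σ.IsEigenProportional ρ →
        σ.rate ρ (fun _ => o) (fun _ => o) (fun _ => o) T =
          ((Real.logb 2 o - f * condEntropy (reduceAB ρ)
            - (1 - f) * condEntropy (reduceAC ρ) : ℝ) : EReal)) ∧
    -- the doubling rate of a strategy is the exponent at which the take-home wealth grows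
    (∀ (σ : Strategy a b c) (f w ε δ : ℝ), 0 < ε → 0 < δ →
      ∃ K₀ : ℕ, ∀ (K : ℕ) (_ : K₀ ≤ K) (T : Finset (Fin K)) (_ : (T.card : ℝ) = f * K),
        σ.rate ρ (fun _ => o) (fun _ => o) (fun _ => o) T = (w : EReal) →
        1 - δ < σ.growthProb ρ (fun _ => o) (fun _ => o) (fun _ => o) T
          (Set.Icc ((2 : ℝ) ^ (K * (w - ε))) ((2 : ℝ) ^ (K * (w + ε))))) ∧
    -- the penalty for `f = 1 / 2` is nonnegative
    0 ≤ condEntropy (reduceAB ρ) + condEntropy (reduceAC ρ) ∧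
    -- hence no strategy has a rate above `log o` when Bob holds `B` in half of the gambles
    (∀ (K : ℕ) (_ : 0 < K) (T : Finset (Fin K)) (_ : 2 * T.card = K) (σ : Strategy a b c),
      σ.rate ρ (fun _ => o) (fun _ => o) (fun _ => o) T ≤ (Real.logb 2 o : EReal)) ∧
    -- `log o` is also the largest rate in the classical game
    (∀ (K : ℕ) (_ : 0 < K) (T : Finset (Fin K)),
      IsGreatest {w | ∃ (p : a × b × c → ℝ) (_ : p ∈ stdSimplex ℝ (a × b × c))
          (qAB : Bet (a × b)) (qAC : Bet (a × c)),
          w = classicalRate p qAB qAC (fun _ => o) (fun _ => o) (fun _ => o) T}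
        (Real.logb 2 o : EReal)) := by
  have ho : ∀ (K : ℕ) (_ : 0 < K) (T : Finset (Fin K)) (_ : 2 * T.card = K)
      (σ : Strategy a b c),
      σ.rate ρ (fun _ => o) (fun _ => o) (fun _ => o) T ≤ (Real.logb 2 o : EReal) := by
    intro K hK T hT σ
    have hf : (T.card : ℝ) = 1 / 2 * K := by
      have : (2 : ℝ) * T.card = K := by exact_mod_cast hT
      linarith
    refine (σ.rate_le hρ hoA hoB hoC hK hf).trans (EReal.coe_le_coe_iff.2 ?_)
    linarith [condEntropy_add_condEntropy_nonneg hρ.1]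
  refine ⟨isGreatest_doublingRate hρ.reduceAB.traceFst hoB,
    isGreatest_doublingRate hρ.reduceAC.traceFst hoC, fun K hK T f hf => ⟨⟨?_, ?_⟩, ?_⟩,
    fun σ f w ε δ hε hδ => ?_, condEntropy_add_condEntropy_nonneg hρ.1, ho,
    fun K hK T => ⟨?_, ?_⟩⟩
  · obtain ⟨σ, hσ⟩ := exists_isEigenProportional hρ
    exact ⟨σ, (hσ.rate_eq hρ hoB hoC hK hf).symm⟩
  · rintro w ⟨σ, rfl⟩
    exact σ.rate_le hρ hoA hoB hoC hK hf
  · exact fun σ hσ => hσ.rate_eq hρ hoB hoC hK hf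
  · obtain ⟨K₀, h⟩ := σ.exists_growthProb_gt hρ hoB hoC w hε hδ
    exact ⟨K₀, fun K hK T _ => h K hK T⟩
  -- The zero-dimensional space carries no state of unit trace, so a deterministic outcome exists.
  · have : Nonempty (a × b × c) := by
      by_contra h
      rw [not_nonempty_iff] at h
      simpa [Matrix.trace] using hρ.2
    exact exists_classicalRate_eq hoB hoC hK
  · rintro w ⟨p, hp, qAB, qAC, rfl⟩
    exact classicalRate_le hp hoA hoB hoC hK qAB qAC
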